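/- Setting. Let $X$ be a measurable space with a nonzero finite base measure $\nu$, and let $t:X\to\mathbb R^n$ be measurable with $\|t(x)\|_2\le R_2$ for all $x$, where $R_2>0$. Let $p_\theta$ be the exponential family with $\nu$-density $\exp(\theta\cdot t(x)-A(\theta))$, $A(\theta)=\log\int e^{\theta\cdot t}\,d\nu$. For data $z_1,\dots,z_N\in X$ ($N\ge1$) and $\lambda\ge0$ put $\bar t=\frac1N\sum_i t(z_i)$, $$f(\theta)=-\frac1N\sum_{i=1}^N\log p_\theta(z_i)+\frac\lambda2\|\theta\|_2^2,\qquad L=4R_2^2+\lambda .$$ Let $\Theta\subseteq\mathbb R^n$ be closed and convex, $\theta^*\in\arg\min_{\theta\in\Theta}f(\theta)$, and let $\theta_0\in\mathbb R^n$ be the starting point. For each $\theta$ let $\mathbb M_\theta$ be a Markov transition operator on $X$ (its kernel jointly measurable in $\theta$ and the state) such that, with constants $C>0$ and $\alpha\in(0,1)$, $\|\mathbb M_\theta^w q-p_\theta\|_{TV}\le C\alpha^w$ for all $\theta\in\Theta\cup\{\theta_0\}$, all probability distributions $q$ and all $w\in\{0,1,2,\dots\}$. Fix a probability distribution $r$ on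 $X$. The algorithm with positive integer parameters $K,M,v$ does the following for $k=1,\dots,K$: it draws, independently given the past, $x_1^{k-1},\dots,x_M^{k-1}\sim\mathbb M_{\theta_{k-1}}^v r$ and sets $$\theta_k=\Pi_\Theta\Big[\theta_{k-1}-\tfrac1L\Big(\tfrac1M\sum_{i=1}^M t(x_i^{k-1})-\bar t+\lambda\theta_{k-1}\Big)\Big],$$ where $\Pi_\Theta$ is the Euclidean projection onto $\Theta$. It uses $KMv$ Markov transitions in total. Theorem. Let $\delta\in(0,1)$, let $\beta_1,\beta_2,\beta_3>0$ with $\beta_1+\beta_2+\beta_3=1$, and let $D\ge\max\left(\|\theta_0-\theta^*\|_2,\frac{4R_2}{L}\log\frac1\delta\right)$. Then for every $\epsilon_f>0$ there are positive integers $K,M,v$, depending only on $R_2,\lambda,C,\alpha,\delta,D,\beta_1,\beta_2,\beta_3,\epsilon_f$, such that $$f\Big(\frac1K\sum_{k=1}^K\theta_k\Big)-f(\theta^*)\le\epsilon_f\quad\text{with probability at least }1-\delta ,$$ and such that, whenever the three real numbers $$\frac{2LD^2}{\beta_1^2\epsilon_f},\qquad \Big(\frac{4DR_2}{\beta_1\beta_2\epsilon_f}\Big)^2,\qquad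 \frac{1}{1-\alpha}\log\frac{4DR_2C}{\beta_1\beta_3\epsilon_f}$$ are all at least $1$ (which holds for all sufficiently small $\epsilon_f$), the total number of Markov transitions satisfies $$KMv\le\frac{32LR_2^2D^4}{\beta_1^4\beta_2^2\epsilon_f^3(1-\alpha)}\log\frac{4DR_2C}{\beta_1\beta_3\epsilon_f}.$$ -/

import Mathlib

open MeasureTheory ProbabilityTheory

namespace MCMCLearning

noncomputable section

/-- Parameter space: `ℝⁿ` with the Euclidean norm. -/
abbrev Param (n : ℕ) : Type := EuclideanSpace ℝ (Fin n)

/-- Log-partition function `A(θ) = log ∫ exp(θ · t(x)) dν(x)`. -/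
def logPartition {n : ℕ} {X : Type*} [MeasurableSpace X] (ν : Measure X) (t : X → Param n)
    (θ : Param n) : ℝ :=
  Real.log (∫ x, Real.exp (inner ℝ θ (t x)) ∂ν)

/-- Density `exp(θ · t(x) - A(θ))` of the exponential family with respect to the base measure
`ν`. -/
def density {n : ℕ} {X : Type*} [MeasurableSpace X] (ν : Measure X) (t : X → Param n)
    (θ : Param n) (x : X) : ℝ :=
  Real.exp (inner ℝ θ (t x) - logPartition ν t θ)

/-- The distribution `p_θ` on `X`. -/
def expFamily {n : ℕ} {X : Type*} [MeasurableSpace X] (ν : Measure X) (t : X → Param n)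
    (θ : Param n) : Measure X :=
  ν.withDensity fun x => ENNReal.ofReal (density ν t θ x)

/-- Regularized negative log-likelihood
`f(θ) = -(1/N) ∑ᵢ log p_θ(zᵢ) + (λ/2) ‖θ‖²` of the data `z₁, …, z_N`. -/
def objective {n N : ℕ} {X : Type*} [MeasurableSpace X] (ν : Measure X) (t : X → Param n)
    (z : Fin N → X) (lam : ℝ) (θ : Param n) : ℝ :=
  -((N : ℝ)⁻¹ * ∑ i, Real.log (density ν t θ (z i))) + lam / 2 * ‖θ‖ ^ 2

/-- Empirical mean `t̄ = (1/N) ∑ᵢ t(zᵢ)` of the sufficient statistics. -/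
def meanStat {n N : ℕ} {X : Type*} (t : X → Param n) (z : Fin N → X) : Param n :=
  (N : ℝ)⁻¹ • ∑ i, t (z i)

/-- Total-variation distance `sup_A |p(A) - q(A)|` over measurable sets. -/
def tvDist {X : Type*} [MeasurableSpace X] (p q : Measure X) : ℝ :=
  ⨆ A : {A : Set X // MeasurableSet A}, |p.real A - q.real A|

/-- `𝕄_θ^v q`: the law after `v` transitions of the chain with parameter `θ`, started from `q`.
The kernel `κ` sends `(θ, x)` to the law of the next state of the chain with parameter `θ` that is
now at `x`. -/
def chainLaw {n : ℕ} {X : Type*} [MeasurableSpace X] (κ : Kernel (Param n × X) X) (θ : Param n)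
    (v : ℕ) (q : Measure X) : Measure X :=
  (fun μ : Measure X => μ.bind fun x => κ (θ, x))^[v] q

open Classical in
/-- Euclidean projection `Π_Θ[φ] = argmin_{θ ∈ Θ} ‖θ - φ‖` (it exists and is unique when `Θ` is
nonempty, closed and convex; the `else` branch is then never used). -/
def proj {n : ℕ} (Θ : Set (Param n)) (φ : Param n) : Param n :=
  if h : ∃ p ∈ Θ, ∀ θ ∈ Θ, ‖p - φ‖ ≤ ‖θ - φ‖ then h.choose else φ

/-- Estimated gradient `(1/M) ∑ᵢ t(xᵢ) - t̄ + λ θ` from a batch of `M` samples. -/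
def gradEstimate {n N M : ℕ} {X : Type*} (t : X → Param n) (z : Fin N → X) (lam : ℝ)
    (θ : Param n) (x : Fin M → X) : Param n :=
  (M : ℝ)⁻¹ • ∑ i, t (x i) - meanStat t z + lam • θ

/-- The parameter `θ_k` that the algorithm has reached when the batches of samples drawn in the
first `k` iterations are `ω 0, …, ω (k-1)`. -/
def iterate {n N M : ℕ} {X : Type*} (t : X → Param n) (z : Fin N → X) (lam L : ℝ)
    (Θ : Set (Param n)) (θ₀ : Param n) : (k : ℕ) → (Fin k → Fin M → X) → Param n
  | 0, _ => θ₀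
  | k + 1, ω =>
    let θ := iterate t z lam L Θ θ₀ k (Fin.init ω)
    proj Θ (θ - L⁻¹ • gradEstimate t z lam θ (ω (Fin.last k)))

/-- Joint law of all the samples drawn in the first `k` iterations: given the first `k` batches, the
next batch consists of `M` independent samples from `𝕄_{θ_k}^v r`. -/
def sampleLaw {n N : ℕ} {X : Type*} [MeasurableSpace X] (κ : Kernel (Param n × X) X)
    (r : Measure X) (t : X → Param n) (z : Fin N → X) (lam L : ℝ) (Θ : Set (Param n))
    (θ₀ : Param n) (M v : ℕ) : (k : ℕ) → Measure (Fin k → Fin M → X)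
  | 0 => Measure.dirac fun i => i.elim0
  | k + 1 =>
    (sampleLaw κ r t z lam L Θ θ₀ M v k).bind fun ω =>
      (Measure.pi fun _ : Fin M => chainLaw κ (iterate t z lam L Θ θ₀ k ω) v r).map
        fun x => Fin.snoc (α := fun _ => Fin M → X) ω x

/-- Averaged output `(1/K) ∑_{k=1}^K θ_k` of a run of `K` iterations with batches `ω`. -/
def averageIterate {n N M K : ℕ} {X : Type*} (t : X → Param n) (z : Fin N → X) (lam L : ℝ)
    (Θ : Set (Param n)) (θ₀ : Param n) (ω : Fin K → Fin M → X) : Param n :=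
  (K : ℝ)⁻¹ • ∑ k : Fin K,
    iterate t z lam L Θ θ₀ (k + 1) fun i : Fin (k + 1) => ω (Fin.castLE k.isLt i)

end

end MCMCLearning

/-!
The log-partition function `A` is convex with a quadratic upper bound of curvature `R²`: the
difference `A(φ) - A(θ)` is the logarithm of the moment-generating function of `t` under `p_θ`, so
Jensen's inequality bounds it from below and Hoeffding's lemma from above. Hence the objective `f`
is convex and `L`-smooth, and with gradient errors `e_k` of total size `S = ∑ ‖e_k‖`, projected
gradient descent drifts from `θ*` by at most `S / L` beyond the initial distance `d`, which gives
`K (f(θ̄) - f(θ*)) ≤ L d² / 2 + S d + S² / L`.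

For one batch, `‖e_k‖` has mean at most `R / √M + 2 R τ`, where `τ` is the total-variation distance
left after `v` transitions, and is sub-Gaussian with variance proxy `R² / M` by McDiarmid's
inequality. These bounds hold at every `θ_k`, so the conditional moment-generating functions
multiply along the run and Chernoff's bound controls `S`.

The schedule takes `K`, `M`, `v` to be the floors of the three real numbers of the theorem. When one
of these is below `1`, the schedule of a smaller target accuracy is used instead.
-/

namespace MCMCLearning

noncomputable section

lemma nonneg_of_norm_le {X E : Type*} [MeasurableSpace X] [NormedAddCommGroup E] (μ : Measure X)
    [NeZero μ] {t : X → E} {R : ℝ} (htR : ∀ x, ‖t x‖ ≤ R) : 0 ≤ R := by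
  have ⟨x⟩ := μ.nonempty_of_neZero
  exact (norm_nonneg _).trans (htR x)

section BoundedStatistic

variable {X E : Type*} [MeasurableSpace X] [NormedAddCommGroup E] [InnerProductSpace ℝ E]
  {μ : Measure X} {t : X → E} {R : ℝ}

lemma inner_mem_Icc_of_norm_le {y : E} (hy : ‖y‖ ≤ R) (h : E) :
    inner ℝ h y ∈ Set.Icc (-(‖h‖ * R)) (‖h‖ * R) :=
  abs_le.1 ((abs_real_inner_le_norm h y).trans (by gcongr))

lemma integrable_exp_inner [IsFiniteMeasure μ] (ht : AEStronglyMeasurable t μ)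
    (htR : ∀ᵐ x ∂μ, ‖t x‖ ≤ R) (h : E) :
    Integrable (fun x => Real.exp (inner ℝ h (t x))) μ := by
  simpa only [one_mul] using integrable_exp_mul_of_mem_Icc (t := 1) ht.const_inner.aemeasurable
    (htR.mono fun _ hx => inner_mem_Icc_of_norm_le hx h)

lemma exp_inner_integral_le [CompleteSpace E] [IsProbabilityMeasure μ]
    (ht : AEStronglyMeasurable t μ) (htR : ∀ᵐ x ∂μ, ‖t x‖ ≤ R) (h : E) :
    Real.exp (inner ℝ h (∫ x, t x ∂μ)) ≤ ∫ x, Real.exp (inner ℝ h (t x)) ∂μ := by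
  have ht_int : Integrable t μ := .of_bound ht R htR
  rw [← integral_inner ht_int]
  exact convexOn_exp.map_integral_le Real.continuous_exp.continuousOn isClosed_univ
    (.of_forall fun _ => Set.mem_univ _) (ht_int.const_inner h) (integrable_exp_inner ht htR h)

lemma integral_exp_mul_le_of_hasSubgaussianMGF {Y : X → ℝ} {m : ℝ} {c : NNReal}
    (hY : HasSubgaussianMGF (fun x => Y x - m) c μ) (s : ℝ) :
    ∫ x, Real.exp (s * Y x) ∂μ ≤ Real.exp (s * m + c * s ^ 2 / 2) := by
  calc ∫ x, Real.exp (s * Y x) ∂μ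
      = Real.exp (s * m) * mgf (fun x => Y x - m) μ s := by
        rw [mgf, ← integral_const_mul]
        simp only [← Real.exp_add, mul_sub, add_sub_cancel]
    _ ≤ Real.exp (s * m) * Real.exp (c * s ^ 2 / 2) := by gcongr; exact hY.mgf_le s
    _ = _ := (Real.exp_add _ _).symm

lemma integral_exp_inner_le [CompleteSpace E] [IsProbabilityMeasure μ]
    (ht : AEStronglyMeasurable t μ) (htR : ∀ᵐ x ∂μ, ‖t x‖ ≤ R) (h : E) :
    ∫ x, Real.exp (inner ℝ h (t x)) ∂μ
      ≤ Real.exp (inner ℝ h (∫ x, t x ∂μ) + R ^ 2 / 2 * ‖h‖ ^ 2) := by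
  have hoeffding := integral_exp_mul_le_of_hasSubgaussianMGF
    (hasSubgaussianMGF_of_mem_Icc ht.const_inner.aemeasurable
      (htR.mono fun _ hx => inner_mem_Icc_of_norm_le hx h)) 1
  rw [integral_inner (.of_bound ht R htR)] at hoeffding
  convert hoeffding using 2
  · simp only [one_mul]
  · push_cast
    rw [Real.norm_eq_abs, div_pow, sq_abs]
    ring

end BoundedStatistic

section ExponentialFamily

variable {n N : ℕ} {X : Type*} [MeasurableSpace X] {ν : Measure X} {t : X → Param n} {R : ℝ}

lemma objective_eq (z : Fin N → X) (hN : 0 < N) (lam : ℝ) (θ : Param n) :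
    objective ν t z lam θ
      = logPartition ν t θ - inner ℝ θ (meanStat t z) + lam / 2 * ‖θ‖ ^ 2 := by
  have hN' : (N : ℝ) ≠ 0 := by positivity
  simp only [objective, density, Real.log_exp, Finset.sum_sub_distrib, Finset.sum_const,
    Finset.card_univ, Fintype.card_fin, nsmul_eq_mul, meanStat, inner_smul_right, inner_sum]
  field_simp
  ring

variable [IsFiniteMeasure ν] [NeZero ν]

lemma integral_exp_inner_pos (ht : Measurable t) (htR : ∀ x, ‖t x‖ ≤ R) (θ : Param n) :
    0 < ∫ x, Real.exp (inner ℝ θ (t x)) ∂ν :=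
  integral_exp_pos (integrable_exp_inner ht.aestronglyMeasurable (.of_forall htR) θ)

lemma expFamily_eq_tilted (ht : Measurable t) (htR : ∀ x, ‖t x‖ ≤ R) (θ : Param n) :
    expFamily ν t θ = ν.tilted fun x => inner ℝ θ (t x) := by
  simp only [expFamily, Measure.tilted, density, logPartition, Real.exp_sub,
    Real.exp_log (integral_exp_inner_pos ht htR θ)]

lemma isProbabilityMeasure_expFamily (ht : Measurable t) (htR : ∀ x, ‖t x‖ ≤ R) (θ : Param n) :
    IsProbabilityMeasure (expFamily ν t θ) := by
  rw [expFamily_eq_tilted ht htR]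
  exact isProbabilityMeasure_tilted
    (integrable_exp_inner ht.aestronglyMeasurable (.of_forall htR) θ)

lemma logPartition_sub (ht : Measurable t) (htR : ∀ x, ‖t x‖ ≤ R) (θ φ : Param n) :
    logPartition ν t φ - logPartition ν t θ
      = Real.log (∫ x, Real.exp (inner ℝ (φ - θ) (t x)) ∂(expFamily ν t θ)) := by
  rw [expFamily_eq_tilted ht htR, integral_exp_tilted, logPartition, logPartition,
    ← Real.log_div (integral_exp_inner_pos ht htR φ).ne' (integral_exp_inner_pos ht htR θ).ne']
  simp only [Pi.add_apply, ← inner_add_left, add_sub_cancel]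

lemma le_logPartition_sub (ht : Measurable t) (htR : ∀ x, ‖t x‖ ≤ R) (θ φ : Param n) :
    inner ℝ (φ - θ) (∫ x, t x ∂(expFamily ν t θ)) ≤ logPartition ν t φ - logPartition ν t θ := by
  have := isProbabilityMeasure_expFamily (ν := ν) ht htR θ
  rw [logPartition_sub ht htR, Real.le_log_iff_exp_le
    (integral_exp_pos (integrable_exp_inner ht.aestronglyMeasurable (.of_forall htR) _))]
  exact exp_inner_integral_le ht.aestronglyMeasurable (.of_forall htR) _

lemma logPartition_sub_le (ht : Measurable t) (htR : ∀ x, ‖t x‖ ≤ R) (θ φ : Param n) :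
    logPartition ν t φ - logPartition ν t θ
      ≤ inner ℝ (φ - θ) (∫ x, t x ∂(expFamily ν t θ)) + R ^ 2 / 2 * ‖φ - θ‖ ^ 2 := by
  have := isProbabilityMeasure_expFamily (ν := ν) ht htR θ
  rw [logPartition_sub ht htR, Real.log_le_iff_le_exp
    (integral_exp_pos (integrable_exp_inner ht.aestronglyMeasurable (.of_forall htR) _))]
  exact integral_exp_inner_le ht.aestronglyMeasurable (.of_forall htR) _

end ExponentialFamily

section InexactGradientDescent

variable {E : Type*} [NormedAddCommGroup E] [InnerProductSpace ℝ E]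

/-- First-order convexity and `L`-smoothness of `F`, with `G` in the role of its gradient; this is
all that the analysis of projected gradient descent uses. -/
structure IsConvexSmooth (F : E → ℝ) (G : E → E) (L : ℝ) : Prop where
  add_inner_le : ∀ x y, F x + inner ℝ (G x) (y - x) ≤ F y
  le_add_inner_add : ∀ x y, F y ≤ F x + inner ℝ (G x) (y - x) + L / 2 * ‖y - x‖ ^ 2

/-- `P` is the nearest-point projection onto `Θ`, characterised by its variational inequality. -/
structure IsProjectionOnto (Θ : Set E) (P : E → E) : Prop where
  mem : ∀ x, P x ∈ Θ
  inner_le_zero : ∀ x, ∀ y ∈ Θ, inner ℝ (x - P x) (y - P x) ≤ 0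

variable {F : E → ℝ} {G : E → E} {L : ℝ} {Θ : Set E} {P : E → E} {y : E}

lemma IsConvexSmooth.convexOn (hF : IsConvexSmooth F G L) : ConvexOn ℝ Set.univ F := by
  refine ⟨convex_univ, fun x _ y _ a b ha hb hab => ?_⟩
  set p := a • x + b • y
  have hx := mul_le_mul_of_nonneg_left (hF.add_inner_le p x) ha
  have hy := mul_le_mul_of_nonneg_left (hF.add_inner_le p y) hb
  have hinner : a * inner ℝ (G p) (x - p) + b * inner ℝ (G p) (y - p) = 0 := by
    rw [← real_inner_smul_right, ← real_inner_smul_right, ← inner_add_right, smul_sub,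
      smul_sub, sub_add_sub_comm, ← add_smul, hab, one_smul, sub_self, inner_zero_right]
  calc F p = a * F p + b * F p := by rw [← add_mul, hab, one_mul]
    _ ≤ a • F x + b • F y := by simp only [smul_eq_mul]; linarith

lemma IsConvexSmooth.map_average_le (hF : IsConvexSmooth F G L) {K : ℕ} (hK : 0 < K)
    (x : ℕ → E) :
    F ((K : ℝ)⁻¹ • ∑ k ∈ Finset.range K, x k) ≤ (K : ℝ)⁻¹ * ∑ k ∈ Finset.range K, F (x k) := by
  rw [Finset.smul_sum, Finset.mul_sum]
  exact hF.convexOn.map_sum_le (fun _ _ => by positivity)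
    (by rw [Finset.sum_const, Finset.card_range, nsmul_eq_mul]; field_simp) fun _ _ => trivial

lemma IsProjectionOnto.norm_sub_le (hP : IsProjectionOnto Θ P) (x x' : E) :
    ‖P x - P x'‖ ≤ ‖x - x'‖ := by
  have hx := hP.inner_le_zero x _ (hP.mem x')
  have hx' := hP.inner_le_zero x' _ (hP.mem x)
  have monotone : ‖P x - P x'‖ ^ 2 ≤ inner ℝ (x - x') (P x - P x') := by
    rw [← real_inner_self_eq_norm_sq]
    simp only [inner_sub_left, inner_sub_right] at hx hx' ⊢
    linarith
  have cauchy := real_inner_le_norm (x - x') (P x - P x')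
  by_contra! hlt
  nlinarith [norm_nonneg (x - x')]

lemma IsProjectionOnto.gap_step_le (hP : IsProjectionOnto Θ P) (hF : IsConvexSmooth F G L)
    (hL : 0 < L) (hy : y ∈ Θ) {x e p : E} (hp : p = P (x - L⁻¹ • (G x + e))) :
    F p - F y ≤ ‖e‖ * ‖p - y‖ + L / 2 * (‖x - y‖ ^ 2 - ‖p - y‖ ^ 2) := by
  have variational : L * inner ℝ (x - p) (y - p) ≤ inner ℝ (G x + e) (y - p) := by
    have h := hP.inner_le_zero (x - L⁻¹ • (G x + e)) y hy
    rwa [← hp, sub_right_comm, inner_sub_left, real_inner_smul_left, sub_nonpos,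
      le_inv_mul_iff₀ hL] at h
  have three_point : ‖x - y‖ ^ 2 = ‖p - x‖ ^ 2 - 2 * inner ℝ (x - p) (y - p) + ‖p - y‖ ^ 2 := by
    rw [← sub_sub_sub_cancel_right x y p, norm_sub_sq_real, norm_sub_rev p x, norm_sub_rev p y]
  have error : inner ℝ e (y - p) ≤ ‖e‖ * ‖p - y‖ := by
    rw [norm_sub_rev p y]
    exact real_inner_le_norm _ _
  have gradient : inner ℝ (G x) (p - x) + inner ℝ (G x) (y - p) = inner ℝ (G x) (y - x) := by
    rw [← inner_add_right, add_comm, sub_add_sub_cancel]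
  have lower := hF.add_inner_le x y
  have upper := hF.le_add_inner_add x p
  rw [inner_add_left] at variational
  rw [three_point]
  linarith

lemma IsProjectionOnto.norm_step_sub_le (hP : IsProjectionOnto Θ P) (hF : IsConvexSmooth F G L)
    (hL : 0 < L) (hy : y ∈ Θ) (hmin : IsMinOn F Θ y) (x e : E) :
    ‖P (x - L⁻¹ • (G x + e)) - y‖ ≤ ‖x - y‖ + ‖e‖ / L := by
  set q := P (x - L⁻¹ • (G x + 0)) with hq
  have exact_step : ‖q - y‖ ≤ ‖x - y‖ := by
    have gap := hP.gap_step_le hF hL hy hq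
    have gap_nonneg : F y ≤ F q := hmin (hP.mem _)
    rw [norm_zero, zero_mul, zero_add] at gap
    have : 0 ≤ ‖x - y‖ ^ 2 - ‖q - y‖ ^ 2 :=
      nonneg_of_mul_nonneg_right ((sub_nonneg.2 gap_nonneg).trans gap) (half_pos hL)
    exact (sq_le_sq₀ (norm_nonneg _) (norm_nonneg _)).1 (by linarith)
  have perturbation : ‖P (x - L⁻¹ • (G x + e)) - q‖ ≤ ‖e‖ / L := by
    refine (hP.norm_sub_le _ _).trans_eq ?_
    rw [sub_sub_sub_cancel_left, ← smul_sub, add_sub_add_left_eq_sub, zero_sub, smul_neg,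
      norm_neg, norm_smul, norm_inv, Real.norm_of_nonneg hL.le, inv_mul_eq_div]
  calc ‖P (x - L⁻¹ • (G x + e)) - y‖
      ≤ ‖P (x - L⁻¹ • (G x + e)) - q‖ + ‖q - y‖ := norm_sub_le_norm_sub_add_norm_sub _ _ _
    _ ≤ ‖x - y‖ + ‖e‖ / L := by linarith

variable {x e : ℕ → E}

lemma norm_inexact_sub_le (hP : IsProjectionOnto Θ P) (hF : IsConvexSmooth F G L) (hL : 0 < L)
    (hy : y ∈ Θ) (hmin : IsMinOn F Θ y)
    (hx : ∀ k, x (k + 1) = P (x k - L⁻¹ • (G (x k) + e k))) (k : ℕ) :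
    ‖x k - y‖ ≤ ‖x 0 - y‖ + (∑ j ∈ Finset.range k, ‖e j‖) / L := by
  induction k with
  | zero => simp
  | succ k ih =>
    rw [hx, Finset.sum_range_succ, add_div]
    linarith [hP.norm_step_sub_le hF hL hy hmin (x k) (e k)]

lemma sum_gap_inexact_le (hP : IsProjectionOnto Θ P) (hF : IsConvexSmooth F G L) (hL : 0 < L)
    (hy : y ∈ Θ) (hmin : IsMinOn F Θ y)
    (hx : ∀ k, x (k + 1) = P (x k - L⁻¹ • (G (x k) + e k))) (K : ℕ) :
    ∑ k ∈ Finset.range K, (F (x (k + 1)) - F y)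
      ≤ L / 2 * ‖x 0 - y‖ ^ 2 + (∑ k ∈ Finset.range K, ‖e k‖) * ‖x 0 - y‖
        + (∑ k ∈ Finset.range K, ‖e k‖) ^ 2 / L := by
  set S := ∑ k ∈ Finset.range K, ‖e k‖
  have distance_le (k : ℕ) (hk : k ∈ Finset.range K) : ‖x (k + 1) - y‖ ≤ ‖x 0 - y‖ + S / L :=
    (norm_inexact_sub_le hP hF hL hy hmin hx (k + 1)).trans <| by
      gcongr
      exact Finset.sum_le_sum_of_subset_of_nonneg
        (Finset.range_subset_range.2 (Finset.mem_range.1 hk)) fun _ _ _ => norm_nonneg _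
  calc ∑ k ∈ Finset.range K, (F (x (k + 1)) - F y)
      ≤ ∑ k ∈ Finset.range K, (‖e k‖ * (‖x 0 - y‖ + S / L)
          + L / 2 * (‖x k - y‖ ^ 2 - ‖x (k + 1) - y‖ ^ 2)) := by
        refine Finset.sum_le_sum fun k hk => (hP.gap_step_le hF hL hy (hx k)).trans ?_
        gcongr
        exact distance_le k hk
    _ = S * (‖x 0 - y‖ + S / L) + L / 2 * (‖x 0 - y‖ ^ 2 - ‖x K - y‖ ^ 2) := by
        rw [Finset.sum_add_distrib, ← Finset.sum_mul, ← Finset.mul_sum,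
          Finset.sum_range_sub' fun k => ‖x k - y‖ ^ 2]
    _ ≤ S * (‖x 0 - y‖ + S / L) + L / 2 * ‖x 0 - y‖ ^ 2 := by
        gcongr
        exact sub_le_self _ (sq_nonneg _)
    _ = L / 2 * ‖x 0 - y‖ ^ 2 + S * ‖x 0 - y‖ + S ^ 2 / L := by ring

lemma gap_average_inexact_le (hP : IsProjectionOnto Θ P) (hF : IsConvexSmooth F G L) (hL : 0 < L)
    (hy : y ∈ Θ) (hmin : IsMinOn F Θ y)
    (hx : ∀ k, x (k + 1) = P (x k - L⁻¹ • (G (x k) + e k))) {K : ℕ} (hK : 0 < K) :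
    F ((K : ℝ)⁻¹ • ∑ k ∈ Finset.range K, x (k + 1)) - F y
      ≤ (K : ℝ)⁻¹ * (L / 2 * ‖x 0 - y‖ ^ 2 + (∑ k ∈ Finset.range K, ‖e k‖) * ‖x 0 - y‖
        + (∑ k ∈ Finset.range K, ‖e k‖) ^ 2 / L) := by
  have hK' : (K : ℝ) ≠ 0 := by positivity
  calc F ((K : ℝ)⁻¹ • ∑ k ∈ Finset.range K, x (k + 1)) - F y
      ≤ (K : ℝ)⁻¹ * ∑ k ∈ Finset.range K, F (x (k + 1)) - F y := by
        gcongr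
        exact hF.map_average_le hK fun k => x (k + 1)
    _ = (K : ℝ)⁻¹ * ∑ k ∈ Finset.range K, (F (x (k + 1)) - F y) := by
        rw [Finset.sum_sub_distrib, Finset.sum_const, Finset.card_range, nsmul_eq_mul, mul_sub,
          inv_mul_cancel_left₀ hK']
    _ ≤ _ := by
        gcongr
        exact sum_gap_inexact_le hP hF hL hy hmin hx K

end InexactGradientDescent

lemma isProjectionOnto_proj {n : ℕ} {Θ : Set (Param n)} (hne : Θ.Nonempty)
    (hc : IsClosed Θ) (hconv : Convex ℝ Θ) : IsProjectionOnto Θ (proj Θ) := by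
  have spec (φ : Param n) : proj Θ φ ∈ Θ ∧ ∀ θ ∈ Θ, ‖proj Θ φ - φ‖ ≤ ‖θ - φ‖ := by
    have nearest : ∃ p ∈ Θ, ∀ θ ∈ Θ, ‖p - φ‖ ≤ ‖θ - φ‖ := by
      obtain ⟨p, hp, hdist⟩ := hc.exists_infDist_eq_dist hne φ
      refine ⟨p, hp, fun θ hθ => ?_⟩
      rw [← dist_eq_norm, ← dist_eq_norm, dist_comm p, dist_comm θ, ← hdist]
      exact Metric.infDist_le_dist_of_mem hθ
    rw [proj, dif_pos nearest]
    exact nearest.choose_spec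
  refine ⟨fun φ => (spec φ).1, fun φ => ?_⟩
  have : Nonempty Θ := hne.to_subtype
  refine (norm_eq_iInf_iff_real_inner_le_zero hconv (spec φ).1).1 ?_
  refine le_antisymm (le_ciInf fun θ => ?_)
    (ciInf_le ⟨0, Set.forall_mem_range.2 fun _ => norm_nonneg _⟩ (⟨_, (spec φ).1⟩ : Θ))
  rw [norm_sub_rev, norm_sub_rev φ]
  exact (spec φ).2 θ θ.2

section RegularizedLikelihood

variable {n N : ℕ} {X : Type*} [MeasurableSpace X] {ν : Measure X} {t : X → Param n} {R : ℝ}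

/-- The gradient of the regularized negative log-likelihood. -/
def objectiveGrad (ν : Measure X) (t : X → Param n) (z : Fin N → X) (lam : ℝ) (θ : Param n) :
    Param n :=
  ∫ x, t x ∂(expFamily ν t θ) - meanStat t z + lam • θ

lemma objective_eq_add_inner_objectiveGrad (z : Fin N → X) (hN : 0 < N) (lam : ℝ)
    (θ φ : Param n) :
    objective ν t z lam φ = objective ν t z lam θ
      + inner ℝ (objectiveGrad ν t z lam θ) (φ - θ)
      + (logPartition ν t φ - logPartition ν t θ - inner ℝ (φ - θ) (∫ x, t x ∂(expFamily ν t θ)))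
      + lam / 2 * ‖φ - θ‖ ^ 2 := by
  have hφ : ‖φ‖ ^ 2 = ‖φ - θ‖ ^ 2 + 2 * inner ℝ (φ - θ) θ + ‖θ‖ ^ 2 := by
    rw [← norm_add_sq_real, sub_add_cancel]
  rw [objective_eq z hN, objective_eq z hN, objectiveGrad, hφ, real_inner_comm (φ - θ)]
  simp only [inner_add_right, inner_sub_right, inner_smul_right,
    inner_sub_left φ θ (meanStat t z)]
  ring

lemma isConvexSmooth_objective [IsFiniteMeasure ν] [NeZero ν] (z : Fin N → X) (hN : 0 < N)
    {lam L : ℝ} (hlam : 0 ≤ lam) (hL : R ^ 2 + lam ≤ L) (ht : Measurable t)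
    (htR : ∀ x, ‖t x‖ ≤ R) :
    IsConvexSmooth (objective ν t z lam) (objectiveGrad ν t z lam) L where
  add_inner_le θ φ := by
    rw [objective_eq_add_inner_objectiveGrad z hN lam θ φ]
    have jensen := le_logPartition_sub (ν := ν) ht htR θ φ
    have ridge : 0 ≤ lam / 2 * ‖φ - θ‖ ^ 2 := by positivity
    linarith
  le_add_inner_add θ φ := by
    rw [objective_eq_add_inner_objectiveGrad z hN lam θ φ]
    have hoeffding := logPartition_sub_le (ν := ν) ht htR θ φ
    have hstep : (R ^ 2 + lam) * ‖φ - θ‖ ^ 2 ≤ L * ‖φ - θ‖ ^ 2 := by gcongr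
    linarith

end RegularizedLikelihood

section Run

variable {n N M : ℕ} {X : Type*} [MeasurableSpace X] {ν : Measure X} {t : X → Param n}
  {z : Fin N → X} {lam L R : ℝ} {Θ : Set (Param n)}

/-- Deviation of the batch mean of the sufficient statistic from its mean under `p_θ`; this is the
error of the estimated gradient. -/
def gradError (ν : Measure X) (t : X → Param n) (θ : Param n) (x : Fin M → X) : Param n :=
  (M : ℝ)⁻¹ • ∑ i, t (x i) - ∫ y, t y ∂(expFamily ν t θ)

lemma gradEstimate_eq_add_gradError (θ : Param n) (x : Fin M → X) :
    gradEstimate t z lam θ x = objectiveGrad ν t z lam θ + gradError ν t θ x := by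
  simp only [gradEstimate, objectiveGrad, gradError]
  abel

/-- Total error `∑_{j<k} ‖e_j‖` of the estimated gradients of the first `k` iterations, defined
along the recursion of `iterate`. -/
def errorSum (ν : Measure X) (t : X → Param n) (z : Fin N → X) (lam L : ℝ) (Θ : Set (Param n))
    (θ₀ : Param n) : (k : ℕ) → (Fin k → Fin M → X) → ℝ
  | 0, _ => 0
  | k + 1, ω => errorSum ν t z lam L Θ θ₀ k (Fin.init ω) +
      ‖gradError ν t (iterate t z lam L Θ θ₀ k (Fin.init ω)) (ω (Fin.last k))‖

lemma errorSum_eq_sum (θ₀ : Param n) (ω : ℕ → Fin M → X) (k : ℕ) :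
    errorSum ν t z lam L Θ θ₀ k (fun i => ω i) = ∑ j ∈ Finset.range k,
      ‖gradError ν t (iterate t z lam L Θ θ₀ j fun i => ω i) (ω j)‖ := by
  induction k with
  | zero => rfl
  | succ k ih =>
    rw [Finset.sum_range_succ, ← ih]
    rfl

lemma gap_averageIterate_le [IsFiniteMeasure ν] [NeZero ν] (hN : 0 < N) (hlam : 0 ≤ lam)
    (hL0 : 0 < L) (hL : R ^ 2 + lam ≤ L) (ht : Measurable t) (htR : ∀ x, ‖t x‖ ≤ R)
    (hc : IsClosed Θ) (hconv : Convex ℝ Θ) {y : Param n} (hy : y ∈ Θ)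
    (hmin : IsMinOn (objective ν t z lam) Θ y) (θ₀ : Param n) {K : ℕ} (hK : 0 < K)
    (ω : Fin K → Fin M → X) :
    objective ν t z lam (averageIterate t z lam L Θ θ₀ ω) - objective ν t z lam y
      ≤ (K : ℝ)⁻¹ * (L / 2 * ‖θ₀ - y‖ ^ 2 + errorSum ν t z lam L Θ θ₀ K ω * ‖θ₀ - y‖
          + errorSum ν t z lam L Θ θ₀ K ω ^ 2 / L) := by
  obtain ⟨ω, rfl⟩ : ∃ ω' : ℕ → Fin M → X, ω = fun i : Fin K => ω' i :=
    ⟨Function.extend Fin.val ω fun _ => ω ⟨0, hK⟩,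
      funext fun i => (Fin.val_injective.extend_apply ω _ i).symm⟩
  set x : ℕ → Param n := fun k => iterate t z lam L Θ θ₀ k fun i => ω i
  have recursion (k : ℕ) :
      x (k + 1) = proj Θ
        (x k - L⁻¹ • (objectiveGrad ν t z lam (x k) + gradError ν t (x k) (ω k))) := by
    rw [← gradEstimate_eq_add_gradError]
    rfl
  have average : averageIterate t z lam L Θ θ₀ (fun i : Fin K => ω i)
      = (K : ℝ)⁻¹ • ∑ k ∈ Finset.range K, x (k + 1) := by
    rw [Finset.sum_range]
    rfl
  rw [average, errorSum_eq_sum]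
  exact gap_average_inexact_le (isProjectionOnto_proj ⟨y, hy⟩ hc hconv)
    (isConvexSmooth_objective z hN hlam hL ht htR) hL0 hy hmin recursion hK

end Run

section TotalVariation

variable {X E : Type*} [MeasurableSpace X] {p q : Measure X} [IsProbabilityMeasure p]
  [IsProbabilityMeasure q]

lemma abs_measureReal_sub_le_tvDist {A : Set X} (hA : MeasurableSet A) :
    |p.real A - q.real A| ≤ tvDist p q :=
  le_ciSup (f := fun A : {A : Set X // MeasurableSet A} => |p.real A - q.real A|)
    ⟨1, Set.forall_mem_range.2 fun _ =>
      abs_sub_le_of_nonneg_of_le measureReal_nonneg measureReal_le_one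
        measureReal_nonneg measureReal_le_one⟩ ⟨A, hA⟩

lemma abs_integral_sub_le_tvDist {Y : X → ℝ} {b : ℝ} (hb : 0 ≤ b) (hY : Measurable Y)
    (hYb : ∀ x, Y x ∈ Set.Icc 0 b) : |∫ x, Y x ∂p - ∫ x, Y x ∂q| ≤ b * tvDist p q := by
  have layercake (m : Measure X) [IsProbabilityMeasure m] :
      ∫ x, Y x ∂m = ∫ s in Set.Ioc 0 b, m.real {x | s ≤ Y x} :=
    (Integrable.of_mem_Icc 0 b hY.aemeasurable (.of_forall hYb)).integral_eq_integral_Ioc_meas_le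
      (.of_forall fun x => (hYb x).1) (.of_forall fun x => (hYb x).2)
  have integrableOn_tail (m : Measure X) [IsProbabilityMeasure m] :
      IntegrableOn (fun s => m.real {x | s ≤ Y x}) (Set.Ioc 0 b) := by
    have hanti : Antitone fun s => m.real {x | s ≤ Y x} := fun s s' h =>
      measureReal_mono fun x (hx : s' ≤ Y x) => h.trans hx
    exact .of_bound measure_Ioc_lt_top hanti.measurable.aestronglyMeasurable 1 <|
      .of_forall fun s => by
        rw [Real.norm_of_nonneg measureReal_nonneg]
        exact measureReal_le_one
  rw [layercake p, layercake q, ← integral_sub (integrableOn_tail p) (integrableOn_tail q),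
    ← Real.norm_eq_abs]
  calc ‖∫ s in Set.Ioc 0 b, (p.real {x | s ≤ Y x} - q.real {x | s ≤ Y x})‖
      ≤ tvDist p q * volume.real (Set.Ioc 0 b) :=
        norm_setIntegral_le_of_norm_le_const measure_Ioc_lt_top fun s _ =>
          abs_measureReal_sub_le_tvDist (measurableSet_le measurable_const hY)
    _ = b * tvDist p q := by rw [Real.volume_real_Ioc_of_le hb, sub_zero, mul_comm]

variable [NormedAddCommGroup E] [InnerProductSpace ℝ E] [CompleteSpace E]

lemma norm_integral_sub_le_tvDist {t : X → E} {R : ℝ} (ht : StronglyMeasurable t)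
    (htR : ∀ x, ‖t x‖ ≤ R) : ‖∫ x, t x ∂p - ∫ x, t x ∂q‖ ≤ 2 * R * tvDist p q := by
  have hR := nonneg_of_norm_le p htR
  set u := ∫ x, t x ∂p - ∫ x, t x ∂q with hu
  have integral_shift (m : Measure X) [IsProbabilityMeasure m] :
      ∫ x, (inner ℝ u (t x) + ‖u‖ * R) ∂m = inner ℝ u (∫ x, t x ∂m) + ‖u‖ * R := by
    have ht_int : Integrable t m := .of_bound ht.aestronglyMeasurable R (.of_forall htR)
    rw [integral_add (ht_int.const_inner u) (integrable_const _), integral_inner ht_int,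
      integral_const, probReal_univ, one_smul]
  have hsq : ‖u‖ * ‖u‖ ≤ ‖u‖ * (2 * R * tvDist p q) := by
    have h := abs_integral_sub_le_tvDist (p := p) (q := q) (b := 2 * (‖u‖ * R))
      (Y := fun x => inner ℝ u (t x) + ‖u‖ * R) (by positivity)
      ((stronglyMeasurable_const.inner ht).measurable.add_const _) fun x => by
        have := inner_mem_Icc_of_norm_le (htR x) u
        exact ⟨by linarith [this.1], by linarith [this.2]⟩
    rw [integral_shift, integral_shift, add_sub_add_right_eq_sub, ← inner_sub_right, ← hu,
      real_inner_self_eq_norm_mul_norm] at h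
    linarith [le_abs_self (‖u‖ * ‖u‖)]
  rcases (norm_nonneg u).eq_or_lt with h0 | hpos
  · have := (abs_nonneg _).trans (abs_measureReal_sub_le_tvDist (p := p) (q := q) .univ)
    rw [← h0]
    positivity
  · exact le_of_mul_le_mul_left hsq hpos

end TotalVariation

section BoundedDifferences

open scoped NNReal

lemma hasSubgaussianMGF_prod {Y Z : Type*} [MeasurableSpace Y] [MeasurableSpace Z] {μ : Measure Y}
    {ν : Measure Z} [SFinite μ] [SFinite ν] {f : Y × Z → ℝ} {m : ℝ} {c₁ c₂ : ℝ≥0}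
    (hf : ∀ s : ℝ, Integrable (fun p => Real.exp (s * (f p - m))) (μ.prod ν))
    (hfst : HasSubgaussianMGF (fun y => ∫ z, f (y, z) ∂ν - m) c₁ μ)
    (hsnd : ∀ y, HasSubgaussianMGF (fun z => f (y, z) - ∫ z, f (y, z) ∂ν) c₂ ν) :
    HasSubgaussianMGF (fun p => f p - m) (c₁ + c₂) (μ.prod ν) where
  integrable_exp_mul := hf
  mgf_le s := by
    have inner_le (y : Y) : ∫ z, Real.exp (s * (f (y, z) - m)) ∂ν
        ≤ Real.exp (s * (∫ z, f (y, z) ∂ν - m)) * Real.exp (c₂ * s ^ 2 / 2) := by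
      calc ∫ z, Real.exp (s * (f (y, z) - m)) ∂ν
          = Real.exp (s * (∫ z, f (y, z) ∂ν - m))
              * mgf (fun z => f (y, z) - ∫ z, f (y, z) ∂ν) ν s := by
            rw [mgf, ← integral_const_mul]
            simp only [← Real.exp_add, ← mul_add, sub_add_sub_cancel']
        _ ≤ _ := by gcongr; exact (hsnd y).mgf_le s
    calc ∫ p, Real.exp (s * (f p - m)) ∂(μ.prod ν)
        = ∫ y, ∫ z, Real.exp (s * (f (y, z) - m)) ∂ν ∂μ := integral_prod _ (hf s)
      _ ≤ ∫ y, Real.exp (s * (∫ z, f (y, z) ∂ν - m)) * Real.exp (c₂ * s ^ 2 / 2) ∂μ :=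
          integral_mono (hf s).integral_prod_left
            ((hfst.integrable_exp_mul s).mul_const _) inner_le
      _ ≤ Real.exp (c₁ * s ^ 2 / 2) * Real.exp (c₂ * s ^ 2 / 2) := by
          rw [integral_mul_const]
          gcongr
          exact hfst.mgf_le s
      _ = Real.exp (↑(c₁ + c₂) * s ^ 2 / 2) := by
          rw [← Real.exp_add, NNReal.coe_add]
          ring_nf

lemma abs_sub_le_sum_of_abs_update_sub_le {ι : Type*} [Fintype ι] [DecidableEq ι]
    {X : ι → Type*} {f : (∀ i, X i) → ℝ} {c : ι → ℝ≥0}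
    (hf : ∀ x i a, |f (Function.update x i a) - f x| ≤ c i) (x y : ∀ i, X i) :
    |f x - f y| ≤ ∑ i, c i := by
  have partial_le (s : Finset ι) : |f (s.piecewise x y) - f y| ≤ ∑ i ∈ s, (c i : ℝ) := by
    induction s using Finset.induction_on with
    | empty => simp
    | insert i s hi ih =>
      rw [Finset.piecewise_insert, Finset.sum_insert hi]
      exact (abs_sub_le _ (f (s.piecewise x y)) _).trans (add_le_add (hf _ _ _) ih)
  simpa only [Finset.piecewise_univ, NNReal.coe_sum] using partial_le Finset.univ

lemma hasSubgaussianMGF_of_abs_sub_le {X : Type*} [MeasurableSpace X] {μ : Measure X}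
    [IsProbabilityMeasure μ] {f : X → ℝ} (hf : Measurable f) {c : ℝ≥0}
    (hfc : ∀ x y, |f x - f y| ≤ c) :
    HasSubgaussianMGF (fun x => f x - ∫ x, f x ∂μ) ((c / 2) ^ 2) μ := by
  have : Nonempty X := μ.nonempty_of_neZero
  have le_add (x y : X) : f x ≤ f y + c := by linarith [le_abs_self (f x - f y), hfc x y]
  have mem_Icc (x : X) : f x ∈ Set.Icc (⨅ y, f y) ((⨅ y, f y) + c) :=
    ⟨ciInf_le ⟨f x - c, Set.forall_mem_range.2 fun y => by linarith [le_add x y]⟩ x,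
      sub_le_iff_le_add.1 <| le_ciInf fun y => by linarith [le_add x y]⟩
  have hoeffding := hasSubgaussianMGF_of_mem_Icc hf.aemeasurable (μ := μ) (.of_forall mem_Icc)
  rwa [add_sub_cancel_left, NNReal.nnnorm_eq] at hoeffding

lemma integrable_of_abs_sub_le {X : Type*} [MeasurableSpace X] {μ : Measure X}
    [IsProbabilityMeasure μ] {f : X → ℝ} (hf : Measurable f) {c : ℝ≥0}
    (hfc : ∀ x y, |f x - f y| ≤ c) : Integrable f μ := by
  have centered := (hasSubgaussianMGF_of_abs_sub_le (μ := μ) hf hfc).integrable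
  exact (centered.add (integrable_const _)).congr (.of_forall fun _ => sub_add_cancel _ _)

lemma abs_integral_sub_integral_le {X : Type*} [MeasurableSpace X] {μ : Measure X}
    [IsProbabilityMeasure μ] {f g : X → ℝ} (hf : Integrable f μ) (hg : Integrable g μ) {c : ℝ}
    (hfg : ∀ x, |f x - g x| ≤ c) : |∫ x, f x ∂μ - ∫ x, g x ∂μ| ≤ c := by
  rw [← integral_sub hf hg, ← Real.norm_eq_abs]
  simpa only [probReal_univ, mul_one] using
    norm_integral_le_of_norm_le_const (μ := μ) (.of_forall hfg)

lemma hasSubgaussianMGF_prod_of_abs_sub_le {Y Z : Type*} [MeasurableSpace Y] [MeasurableSpace Z]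
    {μ : Measure Y} {ν : Measure Z} [IsProbabilityMeasure μ] [IsProbabilityMeasure ν]
    {f : Y × Z → ℝ} (hf : Measurable f) {b c₁ c₂ : ℝ≥0} (hfb : ∀ p q, |f p - f q| ≤ b)
    (hfst : ∀ y y' z, |f (y, z) - f (y', z)| ≤ c₁)
    (hsnd : ∀ y, HasSubgaussianMGF (fun z => f (y, z) - ∫ z, f (y, z) ∂ν) c₂ ν) :
    HasSubgaussianMGF (fun p => f p - ∫ p, f p ∂(μ.prod ν)) ((c₁ / 2) ^ 2 + c₂) (μ.prod ν) := by
  have integrable_slice (y : Y) : Integrable (fun z => f (y, z)) ν :=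
    integrable_of_abs_sub_le (hf.comp measurable_prodMk_left) fun _ _ => hfb _ _
  have marginal : HasSubgaussianMGF
      (fun y => ∫ z, f (y, z) ∂ν - ∫ y, ∫ z, f (y, z) ∂ν ∂μ) ((c₁ / 2) ^ 2) μ :=
    hasSubgaussianMGF_of_abs_sub_le hf.stronglyMeasurable.integral_prod_right'.measurable
      fun _ _ => abs_integral_sub_integral_le (integrable_slice _) (integrable_slice _) (hfst _ _)
  rw [← integral_prod _ (integrable_of_abs_sub_le hf hfb)] at marginal
  exact hasSubgaussianMGF_prod (hasSubgaussianMGF_of_abs_sub_le hf hfb).integrable_exp_mul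
    marginal hsnd

/-- McDiarmid's inequality, on the level of moment-generating functions. -/
lemma hasSubgaussianMGF_of_abs_update_sub_le {m : ℕ} {X : Fin m → Type*}
    [∀ i, MeasurableSpace (X i)] (μ : ∀ i, Measure (X i)) [∀ i, IsProbabilityMeasure (μ i)]
    {f : (∀ i, X i) → ℝ} (hf : Measurable f) {c : Fin m → ℝ≥0}
    (hfc : ∀ x i a, |f (Function.update x i a) - f x| ≤ c i) :
    HasSubgaussianMGF (fun x => f x - ∫ x, f x ∂(Measure.pi μ)) (∑ i, (c i / 2) ^ 2)
      (Measure.pi μ) := by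
  have oscillation := abs_sub_le_sum_of_abs_update_sub_le hfc
  induction m with
  | zero =>
    simpa only [Finset.univ_eq_empty, Finset.sum_empty, zero_div, zero_pow two_ne_zero]
      using hasSubgaussianMGF_of_abs_sub_le hf oscillation
  | succ m ih =>
    set e := MeasurableEquiv.piFinSuccAbove X 0
    set ν := Measure.pi fun j => μ (Fin.succAbove 0 j)
    have he : MeasurePreserving e (Measure.pi μ) ((μ 0).prod ν) :=
      measurePreserving_piFinSuccAbove μ 0
    have hfe : Measurable fun p => f (e.symm p) := hf.comp e.symm.measurable
    have hslice (y : X 0) : Measurable fun z => f (e.symm (y, z)) :=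
      hfe.comp measurable_prodMk_left
    have tail (y : X 0) : HasSubgaussianMGF
        (fun z => f (e.symm (y, z)) - ∫ z, f (e.symm (y, z)) ∂ν)
        (∑ j, (c (Fin.succAbove 0 j) / 2) ^ 2) ν := by
      have hdiff (z j a) : |f (e.symm (y, Function.update z j a)) - f (e.symm (y, z))|
          ≤ c (Fin.succAbove 0 j) := by
        have := hfc (Fin.insertNth 0 y z) (Fin.succAbove 0 j) a
        rwa [← Fin.insertNth_update] at this
      exact ih _ (hslice y) hdiff (abs_sub_le_sum_of_abs_update_sub_le hdiff)
    have head (y y' z) : |f (e.symm (y, z)) - f (e.symm (y', z))| ≤ c 0 := by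
      have := hfc (Fin.insertNth 0 y' z) 0 y
      rwa [Fin.update_insertNth] at this
    have product :=
      hasSubgaussianMGF_prod_of_abs_sub_le (μ := μ 0) hfe (fun _ _ => oscillation _ _) head tail
    rw [he.symm.integral_comp' f, ← he.map_eq] at product
    rw [Fin.sum_univ_succAbove _ 0]
    simpa only [Function.comp_def, e.symm_apply_apply]
      using product.of_map e.measurable.aemeasurable

end BoundedDifferences

section BatchMean

variable {n m : ℕ} {X : Type*} {t : X → Param n} {R : ℝ}

lemma abs_norm_batchMean_update_sub_le (htR : ∀ x, ‖t x‖ ≤ R) (c : Param n) (x : Fin m → X)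
    (i : Fin m) (a : X) :
    |‖(m : ℝ)⁻¹ • ∑ j, t (Function.update x i a j) - c‖ - ‖(m : ℝ)⁻¹ • ∑ j, t (x j) - c‖|
      ≤ 2 * R / m := by
  have hsum : ∑ j, t (Function.update x i a j) - ∑ j, t (x j) = t a - t (x i) := by
    rw [← Finset.sum_sub_distrib, Finset.sum_eq_single i (fun j _ hj => by
      rw [Function.update_of_ne hj, sub_self]) (absurd (Finset.mem_univ i)), Function.update_self]
  calc _ ≤ ‖(m : ℝ)⁻¹ • (t a - t (x i))‖ := by
        refine (abs_norm_sub_norm_le _ _).trans_eq ?_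
        rw [sub_sub_sub_cancel_right, ← smul_sub, hsum]
    _ = ‖t a - t (x i)‖ / m := by
        rw [norm_smul, norm_inv, Real.norm_natCast, inv_mul_eq_div]
    _ ≤ 2 * R / m := by
        gcongr
        linarith [norm_sub_le (t a) (t (x i)), htR a, htR (x i)]

variable [MeasurableSpace X] {μ : Measure X} [IsProbabilityMeasure μ]

lemma memLp_comp_eval {E : Type*} [NormedAddCommGroup E] {Y : X → E} (hY : MemLp Y 2 μ)
    (i : Fin m) : MemLp (fun x : Fin m → X => Y (x i)) 2 (Measure.pi fun _ => μ) :=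
  hY.comp_measurePreserving (measurePreserving_eval _ i)

lemma memLp_sum_pi {E : Type*} [NormedAddCommGroup E] {Y : X → E} (hY : MemLp Y 2 μ) :
    MemLp (fun x : Fin m → X => ∑ i, Y (x i)) 2 (Measure.pi fun _ => μ) :=
  memLp_finsetSum _ fun i _ => memLp_comp_eval hY i

lemma integral_sq_sum_sub_eq {Y : X → ℝ} (hY : MemLp Y 2 μ) :
    ∫ x, (∑ i, Y (x i) - m * ∫ y, Y y ∂μ) ^ 2 ∂(Measure.pi fun _ : Fin m => μ)
      = m * Var[Y; μ] := by
  have integral_sum :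
      ∫ x, ∑ i, Y (x i) ∂(Measure.pi fun _ : Fin m => μ) = m * ∫ y, Y y ∂μ := by
    rw [integral_finsetSum _ fun i _ => (memLp_comp_eval hY i).integrable one_le_two]
    simp only [integral_comp_eval (μ := fun _ => μ) hY.aestronglyMeasurable, Finset.sum_const,
      Finset.card_univ, Fintype.card_fin, nsmul_eq_mul]
  have variance_sum := variance_sum_pi (ι := Fin m) (μ := fun _ => μ) fun _ => hY
  rw [Finset.sum_const, Finset.card_univ, Fintype.card_fin, nsmul_eq_mul] at variance_sum
  rw [← integral_sum, ← variance_sum, Finset.sum_fn,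
    variance_eq_integral (memLp_sum_pi hY).aemeasurable]

lemma integral_norm_sq_sum_sub_le (ht : MemLp t 2 μ) :
    ∫ x, ‖∑ i, t (x i) - (m : ℝ) • ∫ y, t y ∂μ‖ ^ 2 ∂(Measure.pi fun _ : Fin m => μ)
      ≤ m * ∫ y, ‖t y‖ ^ 2 ∂μ := by
  have ht_coord (j : Fin n) : MemLp (fun y => t y j) 2 μ :=
    (EuclideanSpace.proj (𝕜 := ℝ) j).comp_memLp' ht
  have integral_coord (j : Fin n) : (∫ y, t y ∂μ) j = ∫ y, t y j ∂μ :=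
    ((EuclideanSpace.proj (𝕜 := ℝ) j).integral_comp_comm (ht.integrable one_le_two)).symm
  simp only [EuclideanSpace.real_norm_sq_eq, PiLp.sub_apply, PiLp.smul_apply, WithLp.ofLp_sum,
    Finset.sum_apply, smul_eq_mul, integral_coord]
  have integrable_coord (j : Fin n) : Integrable
      (fun x : Fin m → X => (∑ i, t (x i) j - m * ∫ y, t y j ∂μ) ^ 2) (Measure.pi fun _ => μ) :=
    ((memLp_sum_pi (ht_coord j)).sub (memLp_const _)).integrable_sq
  rw [integral_finsetSum _ fun j _ => integrable_coord j,
    integral_finsetSum _ fun j _ => (ht_coord j).integrable_sq, Finset.mul_sum]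
  refine Finset.sum_le_sum fun j _ => ?_
  rw [integral_sq_sum_sub_eq (ht_coord j)]
  gcongr
  exact variance_le_expectation_sq (ht_coord j).aestronglyMeasurable

lemma integral_le_sqrt_integral_sq {Y : X → ℝ} (hY : MemLp Y 2 μ) :
    ∫ x, Y x ∂μ ≤ √(∫ x, Y x ^ 2 ∂μ) := by
  refine Real.le_sqrt_of_sq_le ?_
  have h := variance_nonneg Y μ
  rw [variance_eq_sub hY] at h
  exact sub_nonneg.1 h

lemma integral_norm_sum_sub_le (ht : Measurable t) (htR : ∀ x, ‖t x‖ ≤ R) :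
    ∫ x, ‖∑ i, t (x i) - (m : ℝ) • ∫ y, t y ∂μ‖ ∂(Measure.pi fun _ : Fin m => μ) ≤ R * √m := by
  have ht2 : MemLp t 2 μ := .of_bound ht.aestronglyMeasurable R (.of_forall htR)
  have sq_le : ∫ y, ‖t y‖ ^ 2 ∂μ ≤ R ^ 2 := by
    refine (integral_mono ht2.norm.integrable_sq (integrable_const (R ^ 2)) fun y => ?_).trans_eq ?_
    · gcongr
      exact htR y
    · rw [integral_const, probReal_univ, one_smul]
  calc ∫ x, ‖∑ i, t (x i) - (m : ℝ) • ∫ y, t y ∂μ‖ ∂(Measure.pi fun _ : Fin m => μ)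
      ≤ √(∫ x, ‖∑ i, t (x i) - (m : ℝ) • ∫ y, t y ∂μ‖ ^ 2 ∂(Measure.pi fun _ : Fin m => μ)) :=
        integral_le_sqrt_integral_sq ((memLp_sum_pi ht2).sub (memLp_const _)).norm
    _ ≤ √(m * R ^ 2) := by
        gcongr
        exact (integral_norm_sq_sum_sub_le ht2).trans (by gcongr)
    _ = R * √m := by
        rw [Real.sqrt_mul' _ (sq_nonneg R), Real.sqrt_sq (nonneg_of_norm_le μ htR), mul_comm]

lemma integral_norm_batchMean_sub_le (ht : Measurable t) (htR : ∀ x, ‖t x‖ ≤ R) (hm : 0 < m)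
    (c : Param n) :
    ∫ x, ‖(m : ℝ)⁻¹ • ∑ i, t (x i) - c‖ ∂(Measure.pi fun _ : Fin m => μ)
      ≤ R / √m + ‖∫ y, t y ∂μ - c‖ := by
  set E := ∫ y, t y ∂μ
  set π := Measure.pi fun _ : Fin m => μ
  have hm' : (m : ℝ) ≠ 0 := by positivity
  have integrable_fluctuation : Integrable (fun x : Fin m → X => ‖∑ i, t (x i) - (m : ℝ) • E‖) π :=
    (((memLp_sum_pi (.of_bound ht.aestronglyMeasurable R (.of_forall htR))).sub
      (memLp_const _)).integrable one_le_two).norm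
  calc ∫ x, ‖(m : ℝ)⁻¹ • ∑ i, t (x i) - c‖ ∂π
      ≤ ∫ x, ((m : ℝ)⁻¹ * ‖∑ i, t (x i) - (m : ℝ) • E‖ + ‖E - c‖) ∂π := by
        refine integral_mono_of_nonneg (.of_forall fun _ => norm_nonneg _)
          ((integrable_fluctuation.const_mul _).add (integrable_const _)) (.of_forall fun x => ?_)
        have triangle := norm_add_le ((m : ℝ)⁻¹ • (∑ i, t (x i) - (m : ℝ) • E)) (E - c)
        rwa [smul_sub, inv_smul_smul₀ hm', sub_add_sub_cancel, ← inv_smul_smul₀ hm' E, ← smul_sub,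
          norm_smul, norm_inv, Real.norm_natCast, inv_smul_smul₀ hm' E] at triangle
    _ = (m : ℝ)⁻¹ * ∫ x, ‖∑ i, t (x i) - (m : ℝ) • E‖ ∂π + ‖E - c‖ := by
        rw [integral_add (integrable_fluctuation.const_mul _) (integrable_const _),
          integral_const_mul, integral_const, probReal_univ, one_smul]
    _ ≤ (m : ℝ)⁻¹ * (R * √m) + ‖E - c‖ := by
        gcongr
        exact integral_norm_sum_sub_le ht htR
    _ = R / √m + ‖E - c‖ := by
        rw [inv_mul_eq_div, mul_div_assoc, Real.sqrt_div_self', mul_one_div]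

lemma integral_exp_norm_batchMean_sub_le (ht : Measurable t) (htR : ∀ x, ‖t x‖ ≤ R) (hm : 0 < m)
    (c : Param n) {s : ℝ} (hs : 0 ≤ s) :
    ∫ x, Real.exp (s * ‖(m : ℝ)⁻¹ • ∑ i, t (x i) - c‖) ∂(Measure.pi fun _ : Fin m => μ)
      ≤ Real.exp (s * (R / √m + ‖∫ y, t y ∂μ - c‖) + R ^ 2 / m * s ^ 2 / 2) := by
  lift R to NNReal using nonneg_of_norm_le μ htR
  have measurable_error : Measurable fun x : Fin m → X => ‖(m : ℝ)⁻¹ • ∑ i, t (x i) - c‖ := by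
    fun_prop
  have mcdiarmid := integral_exp_mul_le_of_hasSubgaussianMGF
    (hasSubgaussianMGF_of_abs_update_sub_le (fun _ => μ) measurable_error
      (c := fun _ => 2 * R / m) (mod_cast abs_norm_batchMean_update_sub_le htR c)) s
  have variance_proxy : (↑(∑ _i : Fin m, (2 * R / m / 2 : NNReal) ^ 2) : ℝ) = R ^ 2 / m := by
    rw [Finset.sum_const, Finset.card_univ, Fintype.card_fin, nsmul_eq_mul]
    push_cast
    field_simp
  rw [variance_proxy] at mcdiarmid
  refine mcdiarmid.trans ?_
  gcongr
  exact integral_norm_batchMean_sub_le ht htR hm c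

lemma integrable_exp_norm_batchMean_sub (ht : Measurable t) (htR : ∀ x, ‖t x‖ ≤ R) (c : Param n)
    {s : ℝ} (hs : 0 ≤ s) :
    Integrable (fun x => Real.exp (s * ‖(m : ℝ)⁻¹ • ∑ i, t (x i) - c‖))
      (Measure.pi fun _ : Fin m => μ) := by
  refine .of_bound (C := Real.exp (s * ((m : ℝ)⁻¹ * ∑ _i : Fin m, R + ‖c‖)))
    (Measurable.aestronglyMeasurable (by fun_prop)) (.of_forall fun x => ?_)
  rw [Real.norm_of_nonneg (Real.exp_pos _).le]
  gcongr
  refine (norm_sub_le _ _).trans ?_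
  rw [norm_smul, norm_inv, Real.norm_natCast]
  gcongr
  exact norm_sum_le_of_le _ fun i _ => htR (x i)

end BatchMean

section ChainLaw

variable {n : ℕ} {X : Type*} [MeasurableSpace X] {κ : Kernel (Param n × X) X}

lemma chainLaw_succ (θ : Param n) (v : ℕ) (q : Measure X) :
    chainLaw κ θ (v + 1) q = (chainLaw κ θ v q).bind fun x => κ (θ, x) := by
  simp only [chainLaw, Function.iterate_succ', Function.comp_apply]

variable [IsMarkovKernel κ] (r : Measure X) [IsProbabilityMeasure r]

instance isProbabilityMeasure_chainLaw (θ : Param n) (v : ℕ) :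
    IsProbabilityMeasure (chainLaw κ θ v r) := by
  induction v with
  | zero => simpa only [chainLaw, Function.iterate_zero, id]
  | succ v ih =>
    rw [chainLaw_succ]
    exact inferInstanceAs (IsProbabilityMeasure
      ((chainLaw κ θ v r).bind (κ.comap (Prod.mk θ) measurable_prodMk_left)))

lemma measurable_chainLaw (v : ℕ) : Measurable fun θ => chainLaw κ θ v r := by
  induction v with
  | zero => exact measurable_const
  | succ v ih =>
    let law : Kernel (Param n) X := ⟨fun θ => chainLaw κ θ v r, ih⟩
    have : IsMarkovKernel law := ⟨fun θ => isProbabilityMeasure_chainLaw r θ v⟩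
    refine Measure.measurable_of_measurable_coe _ fun s hs => ?_
    have measurable_transition (θ : Param n) : Measurable fun x => κ (θ, x) :=
      κ.measurable.comp measurable_prodMk_left
    simp only [chainLaw_succ, Measure.bind_apply hs (measurable_transition _).aemeasurable]
    exact Measurable.lintegral_kernel_prod_right (κ := law) (κ.measurable_coe hs)

end ChainLaw

section Chernoff

variable {Ω : Type*} [MeasurableSpace Ω] {μ : Measure Ω} {Y : Ω → ℝ}

lemma measureReal_add_sqrt_le_le_exp_neg (hY : Measurable Y) {m v l : ℝ} (hv : 0 < v)
    (hl : 0 ≤ l) (h : ∀ s, 0 ≤ s → ∫⁻ ω, ENNReal.ofReal (Real.exp (s * Y ω)) ∂μ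
      ≤ ENNReal.ofReal (Real.exp (s * m + v * s ^ 2 / 2))) :
    μ.real {ω | m + √(2 * v * l) ≤ Y ω} ≤ Real.exp (-l) := by
  set a := m + √(2 * v * l) with ha
  set s := √(2 * l / v)
  have exponent_eq : s * m + v * s ^ 2 / 2 - s * a = -l := by
    have hsq : s ^ 2 = 2 * l / v := Real.sq_sqrt (by positivity)
    have hcross : s * √(2 * v * l) = 2 * l := by
      rw [← Real.sqrt_mul (by positivity), show 2 * l / v * (2 * v * l) = (2 * l) ^ 2 by field_simp,
        Real.sqrt_sq (by positivity)]
    rw [ha, mul_add, hcross, hsq, mul_div_cancel₀ _ hv.ne']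
    ring
  refine ENNReal.toReal_le_of_le_ofReal (Real.exp_pos _).le ?_
  calc μ {ω | a ≤ Y ω}
      ≤ μ {ω | ENNReal.ofReal (Real.exp (s * a)) ≤ ENNReal.ofReal (Real.exp (s * Y ω))} :=
        measure_mono fun ω (hω : a ≤ Y ω) => ENNReal.ofReal_le_ofReal (by gcongr)
    _ ≤ (∫⁻ ω, ENNReal.ofReal (Real.exp (s * Y ω)) ∂μ) / ENNReal.ofReal (Real.exp (s * a)) :=
        meas_ge_le_lintegral_div (by fun_prop) (by simp [Real.exp_pos]) ENNReal.ofReal_ne_top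
    _ ≤ ENNReal.ofReal (Real.exp (s * m + v * s ^ 2 / 2)) / ENNReal.ofReal (Real.exp (s * a)) := by
        gcongr
        exact h s (Real.sqrt_nonneg _)
    _ = ENNReal.ofReal (Real.exp (-l)) := by
        rw [← ENNReal.ofReal_div_of_pos (Real.exp_pos _), ← Real.exp_sub, exponent_eq]

end Chernoff

section SampleLaw

lemma measurable_pi_const {Ω X ι : Type*} [MeasurableSpace Ω] [MeasurableSpace X] [Fintype ι]
    {μ : Ω → Measure X} [∀ ω, IsProbabilityMeasure (μ ω)] (hμ : Measurable μ) :
    Measurable fun ω => Measure.pi fun _ : ι => μ ω := by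
  refine Measurable.measure_of_isPiSystem_of_isProbabilityMeasure generateFrom_pi.symm
    isPiSystem_pi ?_
  rintro _ ⟨s, hs, rfl⟩
  simp only [Measure.pi_pi]
  exact Finset.measurable_prod _ fun i _ =>
    (Measure.measurable_coe (hs i (Set.mem_univ i))).comp hμ

lemma measurable_snoc {k : ℕ} {Y : Type*} [MeasurableSpace Y] :
    Measurable fun p : (Fin k → Y) × Y =>
      (Fin.snoc (α := fun _ => Y) p.1 p.2 : Fin (k + 1) → Y) := by
  refine measurable_pi_lambda _ fun i => ?_
  induction i using Fin.lastCases with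
  | last => simpa only [Fin.snoc_last] using measurable_snd
  | cast i =>
    simp only [Fin.snoc_castSucc]
    exact (measurable_pi_apply i).comp measurable_fst

lemma measurable_init {k : ℕ} {Y : Type*} [MeasurableSpace Y] :
    Measurable fun ω : Fin (k + 1) → Y => (Fin.init ω : Fin k → Y) :=
  measurable_pi_lambda _ fun i => measurable_pi_apply i.castSucc

lemma map_id_prod_apply {Ω Y Z : Type*} [MeasurableSpace Ω] [MeasurableSpace Y]
    [MeasurableSpace Z] (η : Kernel Ω Y) [IsSFiniteKernel η] {g : Ω × Y → Z} (hg : Measurable g)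
    (ω : Ω) : (Kernel.id ×ₖ η).map g ω = (η ω).map fun y => g (ω, y) := by
  rw [Kernel.map_apply _ hg, Kernel.prod_apply, Kernel.id_apply, Measure.dirac_prod,
    Measure.map_map hg measurable_prodMk_left]
  rfl

variable {n N M : ℕ} {X : Type*} {t : X → Param n} {z : Fin N → X} {lam L R : ℝ}
  {Θ : Set (Param n)}

lemma iterate_mem_insert (hne : Θ.Nonempty) (hc : IsClosed Θ) (hconv : Convex ℝ Θ) (θ₀ : Param n)
    (k : ℕ) (ω : Fin k → Fin M → X) : iterate t z lam L Θ θ₀ k ω ∈ insert θ₀ Θ := by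
  cases k with
  | zero => exact Set.mem_insert _ _
  | succ k => exact Set.mem_insert_of_mem _ ((isProjectionOnto_proj hne hc hconv).mem _)

variable [MeasurableSpace X] {κ : Kernel (Param n × X) X} {ν : Measure X}

lemma measurable_proj (hne : Θ.Nonempty) (hc : IsClosed Θ) (hconv : Convex ℝ Θ) :
    Measurable (proj Θ) :=
  (LipschitzWith.of_dist_le_mul (K := 1) fun x y => by
    simpa only [dist_eq_norm, NNReal.coe_one, one_mul] using
      (isProjectionOnto_proj hne hc hconv).norm_sub_le x y).continuous.measurable

lemma measurable_iterate (ht : Measurable t) (hne : Θ.Nonempty) (hc : IsClosed Θ)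
    (hconv : Convex ℝ Θ) (θ₀ : Param n) (k : ℕ) :
    Measurable (iterate (M := M) t z lam L Θ θ₀ k) := by
  induction k with
  | zero => exact measurable_const
  | succ k ih =>
    have measurable_previous := ih.comp (measurable_init (Y := Fin M → X))
    refine (measurable_proj hne hc hconv).comp (measurable_previous.sub (.const_smul ?_ L⁻¹))
    unfold gradEstimate
    fun_prop

lemma measurable_integral_expFamily [IsFiniteMeasure ν] [NeZero ν] (ht : Measurable t)
    (htR : ∀ x, ‖t x‖ ≤ R) : Measurable fun θ => ∫ x, t x ∂(expFamily ν t θ) := by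
  simp only [expFamily_eq_tilted ht htR, integral_tilted]
  have measurable_normalization :
      Measurable fun θ : Param n => ∫ x, Real.exp (inner ℝ θ (t x)) ∂ν :=
    (StronglyMeasurable.integral_prod_right (f := fun (θ : Param n) x => Real.exp (inner ℝ θ (t x)))
      (Measurable.stronglyMeasurable (by fun_prop))).measurable
  refine (StronglyMeasurable.integral_prod_right (f := fun (θ : Param n) x =>
    (Real.exp (inner ℝ θ (t x)) / ∫ y, Real.exp (inner ℝ θ (t y)) ∂ν) • t x)
      (Measurable.stronglyMeasurable ?_)).measurable
  exact ((by fun_prop : Measurable fun p : Param n × X => Real.exp (inner ℝ p.1 (t p.2))).div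
    (measurable_normalization.comp measurable_fst)).smul (ht.comp measurable_snd)

lemma measurable_errorSum [IsFiniteMeasure ν] [NeZero ν] (ht : Measurable t)
    (htR : ∀ x, ‖t x‖ ≤ R) (hne : Θ.Nonempty) (hc : IsClosed Θ) (hconv : Convex ℝ Θ)
    (θ₀ : Param n) (k : ℕ) : Measurable (errorSum (M := M) ν t z lam L Θ θ₀ k) := by
  induction k with
  | zero => exact measurable_const
  | succ k ih =>
    have measurable_mean := (measurable_integral_expFamily (ν := ν) ht htR).comp <|
      (measurable_iterate (z := z) (lam := lam) (L := L) ht hne hc hconv θ₀ k).comp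
        (measurable_init (Y := Fin M → X))
    refine (ih.comp measurable_init).add (Measurable.norm ?_)
    unfold gradError
    exact Measurable.sub (by fun_prop) measurable_mean

variable [IsMarkovKernel κ] (r : Measure X) [IsProbabilityMeasure r]

lemma isProbabilityMeasure_sampleLaw (ht : Measurable t) (hne : Θ.Nonempty) (hc : IsClosed Θ)
    (hconv : Convex ℝ Θ) (θ₀ : Param n) (v k : ℕ) :
    IsProbabilityMeasure (sampleLaw κ r t z lam L Θ θ₀ M v k) := by
  induction k with
  | zero => exact Measure.dirac.isProbabilityMeasure
  | succ k ih =>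
    let batch : Kernel (Fin k → Fin M → X) (Fin M → X) :=
      ⟨fun ω => Measure.pi fun _ => chainLaw κ (iterate t z lam L Θ θ₀ k ω) v r,
        measurable_pi_const
          ((measurable_chainLaw r v).comp (measurable_iterate ht hne hc hconv θ₀ k))⟩
    have : IsMarkovKernel batch :=
      ⟨fun ω => inferInstanceAs (IsProbabilityMeasure (Measure.pi _))⟩
    have := Kernel.IsMarkovKernel.map (Kernel.id ×ₖ batch)
      (measurable_snoc (k := k) (Y := Fin M → X))
    have step_eq : sampleLaw κ r t z lam L Θ θ₀ M v (k + 1)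
        = (sampleLaw κ r t z lam L Θ θ₀ M v k).bind ((Kernel.id ×ₖ batch).map
          fun p => (Fin.snoc (α := fun _ => Fin M → X) p.1 p.2 : Fin (k + 1) → Fin M → X)) :=
      congrArg (Measure.bind _)
        (funext fun ω => (map_id_prod_apply batch measurable_snoc ω).symm)
    rw [step_eq]
    infer_instance

end SampleLaw

section ErrorSum

variable {n N M : ℕ} {X : Type*} [MeasurableSpace X] {κ : Kernel (Param n × X) X} {ν : Measure X}
  {t : X → Param n} {z : Fin N → X} {lam L R : ℝ} {Θ : Set (Param n)}

lemma errorSum_nonneg (θ₀ : Param n) (k : ℕ) (ω : Fin k → Fin M → X) :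
    0 ≤ errorSum ν t z lam L Θ θ₀ k ω := by
  induction k with
  | zero => exact le_rfl
  | succ k ih => exact add_nonneg (ih _) (norm_nonneg _)

lemma lintegral_exp_errorSum_le (r : Measure X) (hne : Θ.Nonempty) (hc : IsClosed Θ)
    (hconv : Convex ℝ Θ) (θ₀ : Param n) (v : ℕ) {s b : ℝ} (hb : ∀ θ ∈ insert θ₀ Θ,
      ∫⁻ x, ENNReal.ofReal (Real.exp (s * ‖gradError ν t θ x‖))
        ∂(Measure.pi fun _ : Fin M => chainLaw κ θ v r) ≤ ENNReal.ofReal (Real.exp b)) (k : ℕ) :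
    ∫⁻ ω, ENNReal.ofReal (Real.exp (s * errorSum ν t z lam L Θ θ₀ k ω))
        ∂(sampleLaw κ r t z lam L Θ θ₀ M v k) ≤ ENNReal.ofReal (Real.exp (k * b)) := by
  induction k with
  | zero => simp [sampleLaw, errorSum]
  | succ k ih =>
    rw [sampleLaw]
    calc _ ≤ ∫⁻ ω, ENNReal.ofReal (Real.exp (s * errorSum ν t z lam L Θ θ₀ k ω))
            * ENNReal.ofReal (Real.exp b) ∂(sampleLaw κ r t z lam L Θ θ₀ M v k) := by
          refine (Measure.lintegral_bind_le _ _ _).trans <|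
            lintegral_mono fun ω => (lintegral_map_le _ _).trans ?_
          simp only [errorSum, Fin.init_snoc, Fin.snoc_last, mul_add, Real.exp_add,
            ENNReal.ofReal_mul (Real.exp_pos _).le]
          rw [lintegral_const_mul' _ _ ENNReal.ofReal_ne_top]
          gcongr
          exact hb _ (iterate_mem_insert hne hc hconv θ₀ k ω)
      _ ≤ ENNReal.ofReal (Real.exp (k * b)) * ENNReal.ofReal (Real.exp b) := by
          rw [lintegral_mul_const' _ _ ENNReal.ofReal_ne_top]
          gcongr
      _ = ENNReal.ofReal (Real.exp ((k + 1 : ℕ) * b)) := by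
          rw [← ENNReal.ofReal_mul (Real.exp_pos _).le, ← Real.exp_add, Nat.cast_succ, add_one_mul]

variable [IsFiniteMeasure ν] [NeZero ν]

lemma lintegral_exp_gradError_le (ht : Measurable t) (htR : ∀ x, ‖t x‖ ≤ R) (hM : 0 < M)
    (θ : Param n) {q : Measure X} [IsProbabilityMeasure q] {s τ : ℝ} (hs : 0 ≤ s)
    (hτ : tvDist q (expFamily ν t θ) ≤ τ) :
    ∫⁻ x, ENNReal.ofReal (Real.exp (s * ‖gradError ν t θ x‖)) ∂(Measure.pi fun _ : Fin M => q)
      ≤ ENNReal.ofReal (Real.exp (s * (R / √M + 2 * R * τ) + R ^ 2 / M * s ^ 2 / 2)) := by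
  have := isProbabilityMeasure_expFamily (ν := ν) ht htR θ
  have hR := nonneg_of_norm_le ν htR
  unfold gradError
  rw [← ofReal_integral_eq_lintegral_ofReal (integrable_exp_norm_batchMean_sub ht htR _ hs)
    (.of_forall fun x => (Real.exp_pos _).le)]
  refine ENNReal.ofReal_le_ofReal
    ((integral_exp_norm_batchMean_sub_le ht htR hM _ hs).trans ?_)
  gcongr
  exact (norm_integral_sub_le_tvDist ht.stronglyMeasurable htR).trans (by gcongr)

/-- The value that the total gradient error of `K` iterations exceeds with probability at most
`exp (-l)`, when the batches consist of `M` samples from laws within total-variation distance `τ` of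
their targets. -/
def errorBound (R τ l : ℝ) (K M : ℕ) : ℝ :=
  K * (R / √M + 2 * R * τ) + √(2 * (K * (R ^ 2 / M)) * l)

lemma one_sub_le_measureReal_errorSum_lt [IsMarkovKernel κ] (r : Measure X)
    [IsProbabilityMeasure r] (hR : 0 < R) (ht : Measurable t) (htR : ∀ x, ‖t x‖ ≤ R)
    (hne : Θ.Nonempty) (hc : IsClosed Θ) (hconv : Convex ℝ Θ) (θ₀ : Param n) {K v : ℕ}
    (hK : 0 < K) (hM : 0 < M) {δ τ : ℝ} (hδ0 : 0 < δ) (hδ1 : δ ≤ 1)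
    (hmix : ∀ θ ∈ insert θ₀ Θ, tvDist (chainLaw κ θ v r) (expFamily ν t θ) ≤ τ) :
    1 - δ ≤ (sampleLaw κ r t z lam L Θ θ₀ M v K).real
      {ω | errorSum ν t z lam L Θ θ₀ K ω < errorBound R τ (Real.log (1 / δ)) K M} := by
  have := isProbabilityMeasure_sampleLaw (κ := κ) (M := M) (z := z) (lam := lam) (L := L) r ht hne
    hc hconv θ₀ v K
  have measurable_total : Measurable (errorSum (M := M) ν t z lam L Θ θ₀ K) :=
    measurable_errorSum ht htR hne hc hconv θ₀ K
  have tail := measureReal_add_sqrt_le_le_exp_neg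
    (μ := sampleLaw κ r t z lam L Θ θ₀ M v K) measurable_total
    (m := K * (R / √M + 2 * R * τ)) (v := K * (R ^ 2 / M)) (l := Real.log (1 / δ)) (by positivity)
    (Real.log_nonneg (by rwa [one_le_div hδ0])) fun s hs => by
      refine (lintegral_exp_errorSum_le r hne hc hconv θ₀ v (fun θ hθ =>
        lintegral_exp_gradError_le ht htR hM θ hs (hmix θ hθ)) K).trans_eq ?_
      ring_nf
  rw [← Real.log_inv, one_div, inv_inv, Real.exp_log hδ0, ← one_div, ← errorBound] at tail
  have compl := probReal_compl_eq_one_sub (μ := sampleLaw κ r t z lam L Θ θ₀ M v K)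
    (measurableSet_le (measurable_const (a := errorBound R τ (Real.log (1 / δ)) K M))
      measurable_total)
  simp only [Set.compl_ofPred, not_le] at compl
  rw [compl]
  linarith

lemma one_sub_le_measureReal_gap_averageIterate_le [IsMarkovKernel κ] (r : Measure X)
    [IsProbabilityMeasure r] (hN : 0 < N) (hlam : 0 ≤ lam) (hR : 0 < R) (hL : R ^ 2 + lam ≤ L)
    (ht : Measurable t) (htR : ∀ x, ‖t x‖ ≤ R) (hc : IsClosed Θ) (hconv : Convex ℝ Θ)
    {y : Param n} (hy : y ∈ Θ) (hmin : IsMinOn (objective ν t z lam) Θ y) {θ₀ : Param n}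
    {K v : ℕ} (hK : 0 < K) (hM : 0 < M) {δ τ ε : ℝ} (hδ0 : 0 < δ) (hδ1 : δ ≤ 1)
    (hmix : ∀ θ ∈ insert θ₀ Θ, tvDist (chainLaw κ θ v r) (expFamily ν t θ) ≤ τ)
    (hε : ∀ S, 0 ≤ S → S ≤ errorBound R τ (Real.log (1 / δ)) K M →
      (K : ℝ)⁻¹ * (L / 2 * ‖θ₀ - y‖ ^ 2 + S * ‖θ₀ - y‖ + S ^ 2 / L) ≤ ε) :
    1 - δ ≤ (sampleLaw κ r t z lam L Θ θ₀ M v K).real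
      {ω | objective ν t z lam (averageIterate t z lam L Θ θ₀ ω) - objective ν t z lam y ≤ ε} := by
  have := isProbabilityMeasure_sampleLaw (κ := κ) (M := M) (z := z) (lam := lam) (L := L) r ht
    ⟨y, hy⟩ hc hconv θ₀ v K
  have hL0 : 0 < L := by linarith [pow_pos hR 2]
  refine (one_sub_le_measureReal_errorSum_lt r hR ht htR ⟨y, hy⟩ hc hconv θ₀ hK hM hδ0 hδ1
    hmix).trans (measureReal_mono fun ω hω => ?_)
  exact (gap_averageIterate_le hN hlam hL0 hL ht htR hc hconv hy hmin θ₀ hK ω).trans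
    (hε _ (errorSum_nonneg θ₀ K ω) (le_of_lt (Set.mem_ofPred.1 hω)))

end ErrorSum

section Schedule

open Filter Topology

/-- The real number `2LD²/(β₁²ε)` whose floor is the number of iterations `K`. -/
def numIterations (L D β₁ ε : ℝ) : ℝ :=
  2 * L * D ^ 2 / (β₁ ^ 2 * ε)

/-- The real number `(4DR/(β₁β₂ε))²` whose floor is the number of samples `M` per iteration. -/
def batchSize (R D β₁ β₂ ε : ℝ) : ℝ :=
  (4 * D * R / (β₁ * β₂ * ε)) ^ 2

/-- The real number `log(4DRC/(β₁β₃ε))/(1 - α)` whose floor is the number of Markov transitions `v`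
per sample. -/
def mixingTime (R C α D β₁ β₃ ε : ℝ) : ℝ :=
  Real.log (4 * D * R * C / (β₁ * β₃ * ε)) / (1 - α)

variable {R L C α D β₁ β₂ β₃ ε : ℝ}

lemma tendsto_div_mul_nhdsGT_zero {a b : ℝ} (ha : 0 < a) (hb : 0 < b) :
    Tendsto (fun ε => a / (b * ε)) (𝓝[>] 0) atTop := by
  simp only [← div_div, div_eq_mul_inv (a / b)]
  exact tendsto_inv_nhdsGT_zero.const_mul_atTop (div_pos ha hb)

lemma eventually_one_le_schedule (hR : 0 < R) (hL : 0 < L) (hC : 0 < C) (hα : α < 1) (hD : 0 < D)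
    (hβ₁ : 0 < β₁) (hβ₂ : 0 < β₂) (hβ₃ : 0 < β₃) :
    ∀ᶠ ε in 𝓝[>] 0, 1 ≤ numIterations L D β₁ ε ∧ 1 ≤ batchSize R D β₁ β₂ ε ∧
      1 ≤ mixingTime R C α D β₁ β₃ ε := by
  have iterations : Tendsto (numIterations L D β₁) (𝓝[>] 0) atTop :=
    tendsto_div_mul_nhdsGT_zero (by positivity) (by positivity)
  have batch : Tendsto (batchSize R D β₁ β₂) (𝓝[>] 0) atTop :=
    (tendsto_pow_atTop two_ne_zero).comp
      (tendsto_div_mul_nhdsGT_zero (by positivity) (by positivity))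
  have mixing : Tendsto (mixingTime R C α D β₁ β₃) (𝓝[>] 0) atTop :=
    (Real.tendsto_log_atTop.comp
      (tendsto_div_mul_nhdsGT_zero (by positivity) (by positivity))).atTop_div_const (sub_pos.2 hα)
  exact (iterations.eventually_ge_atTop 1).and
    ((batch.eventually_ge_atTop 1).and (mixing.eventually_ge_atTop 1))

lemma exists_le_one_le_schedule (hR : 0 < R) (hL : 0 < L) (hC : 0 < C) (hα : α < 1) (hD : 0 < D)
    (hβ₁ : 0 < β₁) (hβ₂ : 0 < β₂) (hβ₃ : 0 < β₃) {ε_f : ℝ} (hε_f : 0 < ε_f) :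
    ∃ ε, 0 < ε ∧ ε ≤ ε_f ∧ 1 ≤ numIterations L D β₁ ε ∧ 1 ≤ batchSize R D β₁ β₂ ε ∧
      1 ≤ mixingTime R C α D β₁ β₃ ε ∧
      (1 ≤ numIterations L D β₁ ε_f → 1 ≤ batchSize R D β₁ β₂ ε_f →
        1 ≤ mixingTime R C α D β₁ β₃ ε_f → ε = ε_f) := by
  by_cases h : 1 ≤ numIterations L D β₁ ε_f ∧ 1 ≤ batchSize R D β₁ β₂ ε_f ∧
      1 ≤ mixingTime R C α D β₁ β₃ ε_f
  · exact ⟨ε_f, hε_f, le_rfl, h.1, h.2.1, h.2.2, fun _ _ _ => rfl⟩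
  · obtain ⟨ε, ⟨hK, hM, hv⟩, hε0, hε⟩ := ((eventually_one_le_schedule hR hL hC hα hD hβ₁ hβ₂
      hβ₃).and (Ioc_mem_nhdsGT hε_f)).exists
    exact ⟨ε, hε0, hε, hK, hM, hv, fun hK' hM' hv' => absurd ⟨hK', hM', hv'⟩ h⟩

lemma floor_schedule_mul_le (hL : 0 ≤ L) (hε : 0 ≤ ε) (hv : 0 ≤ mixingTime R C α D β₁ β₃ ε) :
    (⌊numIterations L D β₁ ε⌋₊ : ℝ) * ⌊batchSize R D β₁ β₂ ε⌋₊ * ⌊mixingTime R C α D β₁ β₃ ε⌋₊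
      ≤ 32 * L * R ^ 2 * D ^ 4 / (β₁ ^ 4 * β₂ ^ 2 * ε ^ 3 * (1 - α)) *
        Real.log (4 * D * R * C / (β₁ * β₃ * ε)) := by
  have hK : 0 ≤ numIterations L D β₁ ε := by unfold numIterations; positivity
  have hM : 0 ≤ batchSize R D β₁ β₂ ε := sq_nonneg _
  calc (⌊numIterations L D β₁ ε⌋₊ : ℝ) * ⌊batchSize R D β₁ β₂ ε⌋₊ * ⌊mixingTime R C α D β₁ β₃ ε⌋₊
      ≤ numIterations L D β₁ ε * batchSize R D β₁ β₂ ε * mixingTime R C α D β₁ β₃ ε := by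
        gcongr <;> exact Nat.floor_le ‹_›
    _ = 32 * L * R ^ 2 * D ^ 4 / (β₁ ^ 4 * β₂ ^ 2 * ε ^ 3 * (1 - α)) *
          Real.log (4 * D * R * C / (β₁ * β₃ * ε)) := by
        simp only [numIterations, batchSize, mixingTime, div_eq_mul_inv, mul_inv, mul_pow, inv_pow]
        ring

lemma mul_sq_le_mul_floor_numIterations (hβ₁ : 0 < β₁) (hε : 0 < ε)
    (hK : 1 ≤ numIterations L D β₁ ε) :
    L * D ^ 2 ≤ β₁ ^ 2 * ε * ⌊numIterations L D β₁ ε⌋₊ := by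
  have h := (Nat.div_two_lt_floor hK).le
  nth_rw 1 [numIterations] at h
  rw [div_div, div_le_iff₀ (by positivity)] at h
  linarith

lemma mul_floor_numIterations_le (hL : 0 ≤ L) (hβ₁ : 0 < β₁) (hε : 0 < ε) :
    β₁ ^ 2 * ε * ⌊numIterations L D β₁ ε⌋₊ ≤ 2 * L * D ^ 2 := by
  have h : (⌊numIterations L D β₁ ε⌋₊ : ℝ) ≤ 2 * L * D ^ 2 / (β₁ ^ 2 * ε) :=
    Nat.floor_le (by unfold numIterations; positivity)
  rwa [le_div_iff₀' (by positivity)] at h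

lemma mul_div_sqrt_floor_batchSize_le (hR : 0 ≤ R) (hD : 0 ≤ D) (hβ₁ : 0 < β₁) (hβ₂ : 0 < β₂)
    (hε : 0 < ε) (hM : 1 ≤ batchSize R D β₁ β₂ ε) :
    D * (R / √⌊batchSize R D β₁ β₂ ε⌋₊) ≤ 3 / 8 * (β₁ * β₂ * ε) := by
  have h := Nat.div_two_lt_floor hM
  have hM0 : (0 : ℝ) < ⌊batchSize R D β₁ β₂ ε⌋₊ := by linarith
  nth_rw 1 [batchSize] at h
  rw [div_pow, div_div, div_lt_iff₀ (by positivity)] at h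
  rw [← mul_div_assoc, div_le_iff₀ (Real.sqrt_pos.2 hM0), ← sq_le_sq₀ (by positivity)
    (by positivity), mul_pow _ (√_), Real.sq_sqrt hM0.le]
  have : 0 < ↑⌊batchSize R D β₁ β₂ ε⌋₊ * (β₁ * β₂ * ε) ^ 2 := by positivity
  linarith

lemma pow_floor_mul_exp_le {c : ℝ} (hα0 : 0 ≤ α) (hα1 : α ≤ 1) (hc : 1 ≤ c) :
    α ^ ⌊c⌋₊ * Real.exp ((1 - α) * c) ≤ 7 / 5 := by
  have mul_exp_le (y : ℝ) : y * Real.exp (1 - y) ≤ 1 := by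
    calc y * Real.exp (1 - y) ≤ Real.exp (y - 1) * Real.exp (1 - y) := by
          gcongr
          linarith [Real.add_one_le_exp (y - 1)]
      _ = 1 := by rw [← Real.exp_add, sub_add_sub_cancel, sub_self, Real.exp_zero]
  have one_le_floor : ⌊c⌋₊ ≠ 0 := (Nat.floor_pos.2 hc).ne'
  calc α ^ ⌊c⌋₊ * Real.exp ((1 - α) * c)
      ≤ α ^ ⌊c⌋₊ * Real.exp ((1 - α) * (⌊c⌋₊ + 1)) := by
        gcongr
        exact (Nat.lt_floor_add_one c).le
    _ = (α * Real.exp (1 - α)) ^ ⌊c⌋₊ * Real.exp (1 - α) := by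
        rw [mul_pow, ← Real.exp_nat_mul, mul_assoc, ← Real.exp_add]
        ring_nf
    _ ≤ α * Real.exp (1 - α) * Real.exp (1 - α) := by
        gcongr
        exact pow_le_of_le_one (by positivity) (mul_exp_le α) one_le_floor
    _ = 2 * α * Real.exp (1 - 2 * α) * Real.exp 1 / 2 := by
        rw [mul_assoc α, mul_assoc (2 * α), ← Real.exp_add, ← Real.exp_add]
        ring_nf
    _ ≤ 1 * Real.exp 1 / 2 := by
        gcongr
        exact mul_exp_le (2 * α)
    _ ≤ 7 / 5 := by linarith [Real.exp_one_lt_d9]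

lemma mul_pow_floor_mixingTime_le (hR : 0 < R) (hC : 0 < C) (hα0 : 0 ≤ α) (hα1 : α < 1)
    (hD : 0 < D) (hβ₁ : 0 < β₁) (hβ₃ : 0 < β₃) (hε : 0 < ε)
    (hv : 1 ≤ mixingTime R C α D β₁ β₃ ε) :
    D * (2 * R * (C * α ^ ⌊mixingTime R C α D β₁ β₃ ε⌋₊)) ≤ 7 / 10 * (β₁ * β₃ * ε) := by
  have h := pow_floor_mul_exp_le hα0 hα1.le hv
  have exp_eq : Real.exp ((1 - α) * mixingTime R C α D β₁ β₃ ε)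
      = 4 * D * R * C / (β₁ * β₃ * ε) := by
    rw [mixingTime, mul_div_cancel₀ _ (sub_pos.2 hα1).ne', Real.exp_log (by positivity)]
  rw [exp_eq, mul_div_assoc', div_le_iff₀ (by positivity)] at h
  linarith

lemma mul_sqrt_deviation_le {K M l : ℝ} (hR : 0 ≤ R) (hD : 0 ≤ D) (hβ₁ : 0 ≤ β₁) (hβ₂ : 0 ≤ β₂)
    (hε : 0 ≤ ε) (hK0 : 0 ≤ K) (hM1 : 1 ≤ M) (hl : 0 ≤ l) (hlD : 4 * R * l ≤ L * D)
    (hK : L * D ^ 2 ≤ β₁ ^ 2 * ε * K) (hM : D * (R / √M) ≤ 3 / 8 * (β₁ * β₂ * ε)) :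
    D * √(2 * (K * (R ^ 2 / M)) * l) ≤ K * (1 / 4 * (β₁ * (β₁ + β₂) * ε)) := by
  have deviation_per_sample : D * R / M ≤ 3 / 8 * (β₁ * β₂ * ε) :=
    calc D * R / M ≤ D * R / √M := by
          gcongr
          exact Real.sqrt_le_self_iff.2 (.inr hM1)
      _ ≤ 3 / 8 * (β₁ * β₂ * ε) := by rwa [mul_div_assoc]
  have confidence : 4 * (D * R * l) ≤ β₁ ^ 2 * ε * K := by nlinarith
  have am_gm : 4 * (β₁ * β₂) ≤ (β₁ + β₂) ^ 2 := by linarith [sq_nonneg (β₁ - β₂)]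
  rw [← sq_le_sq₀ (by positivity) (by positivity), mul_pow, Real.sq_sqrt (by positivity)]
  calc D ^ 2 * (2 * (K * (R ^ 2 / M)) * l)
      = K / 2 * (D * R / M) * (4 * (D * R * l)) := by ring
    _ ≤ K / 2 * (3 / 8 * (β₁ * β₂ * ε)) * (β₁ ^ 2 * ε * K) := by gcongr
    _ = 3 / 64 * (K * β₁ * ε) ^ 2 * (4 * (β₁ * β₂)) := by ring
    _ ≤ 4 / 64 * (K * β₁ * ε) ^ 2 * (β₁ + β₂) ^ 2 := by gcongr; norm_num
    _ = (K * (1 / 4 * (β₁ * (β₁ + β₂) * ε))) ^ 2 := by ring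

lemma inexact_gap_le {K S d : ℝ} (hL : 0 < L) (hβ₁0 : 0 < β₁) (hβ₁1 : β₁ ≤ 1) (hε : 0 < ε)
    (hK : 0 < K) (hS0 : 0 ≤ S) (hd0 : 0 ≤ d) (hd : d ≤ D)
    (hK_lower : L * D ^ 2 ≤ β₁ ^ 2 * ε * K) (hK_upper : β₁ ^ 2 * ε * K ≤ 2 * L * D ^ 2)
    (hS : D * S ≤ K * (β₁ * ε * (7 / 10 - 9 / 20 * β₁))) :
    K⁻¹ * (L / 2 * d ^ 2 + S * d + S ^ 2 / L) ≤ ε := by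
  have initial : L / 2 * d ^ 2 ≤ K * (β₁ ^ 2 / 2 * ε) :=
    calc L / 2 * d ^ 2 ≤ L / 2 * D ^ 2 := by gcongr
      _ ≤ K * (β₁ ^ 2 / 2 * ε) := by linarith
  have linear : S * d ≤ K * (β₁ * (7 / 10 - 9 / 20 * β₁) * ε) :=
    calc S * d ≤ S * D := by gcongr
      _ ≤ K * (β₁ * (7 / 10 - 9 / 20 * β₁) * ε) := by linarith
  have quadratic : S ^ 2 / L ≤ K * (2 * (7 / 10 - 9 / 20 * β₁) ^ 2 * ε) := by
    rw [div_le_iff₀ hL]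
    refine le_of_mul_le_mul_left ?_ (by positivity : 0 < β₁ ^ 2 * ε * K)
    calc β₁ ^ 2 * ε * K * S ^ 2 ≤ 2 * L * D ^ 2 * S ^ 2 := by gcongr
      _ = 2 * L * (D * S) ^ 2 := by ring
      _ ≤ 2 * L * (K * (β₁ * ε * (7 / 10 - 9 / 20 * β₁))) ^ 2 := by
          have := hd0.trans hd
          gcongr
      _ = β₁ ^ 2 * ε * K * (K * (2 * (7 / 10 - 9 / 20 * β₁) ^ 2 * ε) * L) := by ring
  have coefficients_le_one : β₁ ^ 2 / 2 + β₁ * (7 / 10 - 9 / 20 * β₁)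
      + 2 * (7 / 10 - 9 / 20 * β₁) ^ 2 ≤ 1 := by nlinarith
  rw [inv_mul_le_iff₀ hK]
  calc L / 2 * d ^ 2 + S * d + S ^ 2 / L
      ≤ K * ((β₁ ^ 2 / 2 + β₁ * (7 / 10 - 9 / 20 * β₁) + 2 * (7 / 10 - 9 / 20 * β₁) ^ 2) * ε) := by
        linarith
    _ ≤ K * (1 * ε) := by gcongr
    _ = K * ε := by rw [one_mul]

lemma mul_errorBound_schedule_le {l : ℝ} (hR : 0 < R) (hC : 0 < C) (hα0 : 0 ≤ α)
    (hα1 : α < 1) (hD : 0 < D) (hβ₁ : 0 < β₁) (hβ₂ : 0 < β₂) (hβ₃ : 0 < β₃)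
    (hβ : β₁ + β₂ + β₃ ≤ 1) (hε : 0 < ε) (hl : 0 ≤ l) (hlD : 4 * R * l ≤ L * D)
    (hK : 1 ≤ numIterations L D β₁ ε) (hM : 1 ≤ batchSize R D β₁ β₂ ε)
    (hv : 1 ≤ mixingTime R C α D β₁ β₃ ε) :
    D * errorBound R (C * α ^ ⌊mixingTime R C α D β₁ β₃ ε⌋₊) l ⌊numIterations L D β₁ ε⌋₊
        ⌊batchSize R D β₁ β₂ ε⌋₊
      ≤ ⌊numIterations L D β₁ ε⌋₊ * (β₁ * ε * (7 / 10 - 9 / 20 * β₁)) := by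
  have batch := mul_div_sqrt_floor_batchSize_le hR.le hD.le hβ₁ hβ₂ hε hM
  have mixing := mul_pow_floor_mixingTime_le hR hC hα0 hα1 hD hβ₁ hβ₃ hε hv
  have deviation := mul_sqrt_deviation_le hR.le hD.le hβ₁.le hβ₂.le hε.le
    (Nat.cast_nonneg ⌊numIterations L D β₁ ε⌋₊) (Nat.one_le_cast.2 (Nat.floor_pos.2 hM)) hl hlD
    (mul_sq_le_mul_floor_numIterations hβ₁ hε hK) batch
  have weights : 3 / 8 * β₂ + 7 / 10 * β₃ + 1 / 4 * (β₁ + β₂) ≤ 7 / 10 - 9 / 20 * β₁ := by linarith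
  unfold errorBound
  set K := (⌊numIterations L D β₁ ε⌋₊ : ℝ)
  set M := (⌊batchSize R D β₁ β₂ ε⌋₊ : ℝ)
  set bias := C * α ^ ⌊mixingTime R C α D β₁ β₃ ε⌋₊
  calc D * (K * (R / √M + 2 * R * bias) + √(2 * (K * (R ^ 2 / M)) * l))
      = K * (D * (R / √M) + D * (2 * R * bias)) + D * √(2 * (K * (R ^ 2 / M)) * l) := by ring
    _ ≤ K * (3 / 8 * (β₁ * β₂ * ε) + 7 / 10 * (β₁ * β₃ * ε))
          + K * (1 / 4 * (β₁ * (β₁ + β₂) * ε)) := by gcongr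
    _ = K * (β₁ * ε * (3 / 8 * β₂ + 7 / 10 * β₃ + 1 / 4 * (β₁ + β₂))) := by ring
    _ ≤ K * (β₁ * ε * (7 / 10 - 9 / 20 * β₁)) := by gcongr

lemma schedule_gap_le {d l : ℝ} (hR : 0 < R) (hL : 0 < L) (hC : 0 < C) (hα0 : 0 ≤ α)
    (hα1 : α < 1) (hD : 0 < D) (hβ₁ : 0 < β₁) (hβ₂ : 0 < β₂) (hβ₃ : 0 < β₃)
    (hβ : β₁ + β₂ + β₃ ≤ 1) (hε : 0 < ε) (hl : 0 ≤ l) (hlD : 4 * R * l ≤ L * D)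
    (hK : 1 ≤ numIterations L D β₁ ε) (hM : 1 ≤ batchSize R D β₁ β₂ ε)
    (hv : 1 ≤ mixingTime R C α D β₁ β₃ ε) (hd0 : 0 ≤ d) (hd : d ≤ D) {S : ℝ}
    (hS0 : 0 ≤ S) (hS : S ≤ errorBound R (C * α ^ ⌊mixingTime R C α D β₁ β₃ ε⌋₊) l
      ⌊numIterations L D β₁ ε⌋₊ ⌊batchSize R D β₁ β₂ ε⌋₊) :
    (⌊numIterations L D β₁ ε⌋₊ : ℝ)⁻¹ * (L / 2 * d ^ 2 + S * d + S ^ 2 / L) ≤ ε := by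
  refine inexact_gap_le hL hβ₁ (by linarith) hε (Nat.cast_pos.2 (Nat.floor_pos.2 hK)) hS0 hd0 hd
    (mul_sq_le_mul_floor_numIterations hβ₁ hε hK) (mul_floor_numIterations_le hL.le hβ₁ hε) ?_
  exact (mul_le_mul_of_nonneg_left hS hD.le).trans
    (mul_errorBound_schedule_le hR hC hα0 hα1 hD hβ₁ hβ₂ hβ₃ hβ hε hl hlD hK hM hv)

end Schedule

end

end MCMCLearning

open MCMCLearning in
theorem theorem5_general
    (R₂ lam L C α δ D β₁ β₂ β₃ ε_f : ℝ)
    (hR₂ : 0 < R₂) (hlam : 0 ≤ lam) (hL : R₂ ^ 2 + lam ≤ L)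
    (hC : 0 < C) (hα0 : 0 ≤ α) (hα1 : α < 1) (hδ0 : 0 < δ) (hδ1 : δ < 1)
    (hβ₁ : 0 < β₁) (hβ₂ : 0 < β₂) (hβ₃ : 0 < β₃) (hβ : β₁ + β₂ + β₃ ≤ 1)
    (hε : 0 < ε_f)
    (hDδ : 4 * R₂ / L * Real.log (1 / δ) ≤ D) :
    ∃ K M v : ℕ, 0 < K ∧ 0 < M ∧ 0 < v ∧
      (∀ (n N : ℕ) (X : Type*) [MeasurableSpace X]
        (ν : Measure X) [IsFiniteMeasure ν] [NeZero ν]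
        (t : X → Param n) (_ht : Measurable t) (_htR : ∀ x, ‖t x‖ ≤ R₂)
        (_hN : 0 < N) (z : Fin N → X)
        (Θ : Set (Param n)) (_hΘclosed : IsClosed Θ) (_hΘconvex : Convex ℝ Θ)
        (κ : Kernel (Param n × X) X) [IsMarkovKernel κ]
        (r : Measure X) [IsProbabilityMeasure r]
        (θ₀ θstar : Param n)
        (_hmix : ∀ θ ∈ insert θ₀ Θ, tvDist (chainLaw κ θ v r) (expFamily ν t θ) ≤ C * α ^ v)
        (_hstar : θstar ∈ Θ) (_hmin : IsMinOn (objective ν t z lam) Θ θstar)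
        (_hD : ‖θ₀ - θstar‖ ≤ D),
        1 - δ ≤ (sampleLaw κ r t z lam L Θ θ₀ M v K).real
          {ω | objective ν t z lam (averageIterate t z lam L Θ θ₀ ω) - objective ν t z lam θstar
            ≤ ε_f}) ∧
      (1 ≤ 2 * L * D ^ 2 / (β₁ ^ 2 * ε_f) →
        1 ≤ (4 * D * R₂ / (β₁ * β₂ * ε_f)) ^ 2 →
        1 ≤ Real.log (4 * D * R₂ * C / (β₁ * β₃ * ε_f)) / (1 - α) →
        (K : ℝ) * M * v ≤
          32 * L * R₂ ^ 2 * D ^ 4 / (β₁ ^ 4 * β₂ ^ 2 * ε_f ^ 3 * (1 - α)) *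
            Real.log (4 * D * R₂ * C / (β₁ * β₃ * ε_f))) := by
  have hL0 : 0 < L := by linarith [pow_pos hR₂ 2]
  have hl : 0 < Real.log (1 / δ) := Real.log_pos (by rwa [one_lt_div hδ0])
  have hD : 0 < D := lt_of_lt_of_le (by positivity) hDδ
  have hlD : 4 * R₂ * Real.log (1 / δ) ≤ L * D := by
    rwa [div_mul_eq_mul_div, div_le_iff₀' hL0] at hDδ
  obtain ⟨ε, hε0, hεε_f, hK, hM, hv, hε_eq⟩ :=
    exists_le_one_le_schedule (ε_f := ε_f) hR₂ hL0 hC hα1 hD hβ₁ hβ₂ hβ₃ hε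
  refine ⟨⌊numIterations L D β₁ ε⌋₊, ⌊batchSize R₂ D β₁ β₂ ε⌋₊, ⌊mixingTime R₂ C α D β₁ β₃ ε⌋₊,
    Nat.floor_pos.2 hK, Nat.floor_pos.2 hM, Nat.floor_pos.2 hv, ?_, fun hK' hM' hv' => ?_⟩
  · intro n N X _ ν _ _ t ht htR hN z Θ hc hconv κ _ r _ θ₀ θstar hmix hstar hmin hθ₀
    exact one_sub_le_measureReal_gap_averageIterate_le r hN hlam hR₂ hL ht htR hc hconv hstar hmin
      (Nat.floor_pos.2 hK) (Nat.floor_pos.2 hM) hδ0 hδ1.le hmix fun S hS0 hS =>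
        (schedule_gap_le hR₂ hL0 hC hα0 hα1 hD hβ₁ hβ₂ hβ₃ hβ hε0 hl.le hlD hK hM hv
          (norm_nonneg _) hθ₀ hS0 hS).trans hεε_f
  · rw [hε_eq hK' hM' hv']
    exact floor_schedule_mul_le hL0.le hε.le (zero_le_one.trans hv')

theorem theorem5
    (R₂ lam L C α δ D β₁ β₂ β₃ ε_f : ℝ)
    (hR₂ : 0 < R₂) (hlam : 0 ≤ lam) (hL : L = 4 * R₂ ^ 2 + lam)
    (hC : 0 < C) (hα0 : 0 < α) (hα1 : α < 1) (hδ0 : 0 < δ) (hδ1 : δ < 1)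
    (hβ₁ : 0 < β₁) (hβ₂ : 0 < β₂) (hβ₃ : 0 < β₃) (hβ : β₁ + β₂ + β₃ = 1)
    (hε : 0 < ε_f)
    (hDδ : 4 * R₂ / L * Real.log (1 / δ) ≤ D) :
    ∃ K M v : ℕ, 0 < K ∧ 0 < M ∧ 0 < v ∧
      -- the guarantee, for every problem with these constants
      (∀ (n N : ℕ) (X : Type*) [MeasurableSpace X]
        (ν : Measure X) [IsFiniteMeasure ν] [NeZero ν]
        (t : X → MCMCLearning.Param n) (_ht : Measurable t) (_htR : ∀ x, ‖t x‖ ≤ R₂)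
        (_hN : 0 < N) (z : Fin N → X)
        (Θ : Set (MCMCLearning.Param n)) (_hΘclosed : IsClosed Θ) (_hΘconvex : Convex ℝ Θ)
        (κ : Kernel (MCMCLearning.Param n × X) X) [IsMarkovKernel κ]
        (r : Measure X) [IsProbabilityMeasure r]
        (θ₀ θstar : MCMCLearning.Param n)
        (_hmix : ∀ θ ∈ insert θ₀ Θ, ∀ q : Measure X, IsProbabilityMeasure q → ∀ w : ℕ,
          MCMCLearning.tvDist (MCMCLearning.chainLaw κ θ w q)
            (MCMCLearning.expFamily ν t θ) ≤ C * α ^ w)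
        (_hstar : θstar ∈ Θ) (_hmin : IsMinOn (MCMCLearning.objective ν t z lam) Θ θstar)
        (_hD : ‖θ₀ - θstar‖ ≤ D),
        1 - δ ≤ (MCMCLearning.sampleLaw κ r t z lam L Θ θ₀ M v K).real
          {ω | MCMCLearning.objective ν t z lam
                (MCMCLearning.averageIterate t z lam L Θ θ₀ ω)
              - MCMCLearning.objective ν t z lam θstar ≤ ε_f}) ∧
      -- the bound on the total number of Markov transitions, provided that the real numbers
      -- that the schedule prescribes for `K`, `M`, `v` are at least one
      (1 ≤ 2 * L * D ^ 2 / (β₁ ^ 2 * ε_f) →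
        1 ≤ (4 * D * R₂ / (β₁ * β₂ * ε_f)) ^ 2 →
        1 ≤ Real.log (4 * D * R₂ * C / (β₁ * β₃ * ε_f)) / (1 - α) →
        (K : ℝ) * M * v ≤
          32 * L * R₂ ^ 2 * D ^ 4 / (β₁ ^ 4 * β₂ ^ 2 * ε_f ^ 3 * (1 - α)) *
            Real.log (4 * D * R₂ * C / (β₁ * β₃ * ε_f))) := by
  obtain ⟨K, M, v, hK, hM, hv, guarantee, transitions⟩ := theorem5_general R₂ lam L C α δ D β₁ β₂ β₃
    ε_f hR₂ hlam (by nlinarith) hC hα0.le hα1 hδ0 hδ1 hβ₁ hβ₂ hβ₃ hβ.le hε hDδ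
  exact ⟨K, M, v, hK, hM, hv, fun n N X _ ν _ _ t ht htR hN z Θ hc hconv κ _ r hr θ₀ θstar hmix =>
    guarantee n N X ν t ht htR hN z Θ hc hconv κ r θ₀ θstar fun θ hθ => hmix θ hθ r hr v,
    transitions⟩
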